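/- Fix a non-principal ultrafilter $\mathfrak u$ on $\mathbb N$. Let $G$ be a locally compact second countable (Hausdorff) unimodular group with Haar measure $\lambda$, acting in a Borel and measure preserving way on standard probability spaces $(X_n,\mu_n)$, $n\in\mathbb N$. Let $U'\subset G$ be an open neighborhood of the identity and for every $n$ let $Y_n\subset X_n$ be a $U'$-cross section, i.e. a Borel set such that $\Phi_n(g,y)=gy$ is injective on $U'\times Y_n$ and $\mu_n(X_n\setminus GY_n)=0$. Let $\nu_n$ be the probability measure on $Y_n$ and $0<\operatorname{covol}(Y_n)<\infty$ the number with $(\Phi_n)_*(\lambda|_{U'}\times\nu_n)=\operatorname{covol}(Y_n)\,\mu_n|_{\Phi_n(U'\times Y_n)}$. Assume that $\{\operatorname{covol}(Y_n)\}_n$ is bounded (equivalently, $\{\operatorname{covol}(Y_n)^{-1}\}_n$ is bounded away from $0$). Let $U\subset U'$ be a compact neighborhood of the identity. Notation. All measure spaces are completed. $Y_{\mathfrak u}=\prod_nY_n/\!\sim_{\mathfrak u}$, where $(y_n)_n\sim_{\mathfrak u}(y_n')_n$ if $y_n=y_n'$ for $\mathfrak u$-almost every $n$, carries the Loeb measure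 $\nu_{\mathfrak u}$, determined by $\nu_{\mathfrak u}([A_n]_{\mathfrak u})=\lim_{\mathfrak u}\nu_n(A_n)$ for measurable $A_n\subset Y_n$; similarly for $(X_{\mathfrak u},\mu_{\mathfrak u})$. The regular ultraproduct $X_{\mathfrak u}^R$ is $\prod_nX_n$ modulo the relation: $(x_n)_n\sim(x_n')_n$ if there are $g_n\in G$ with $\lim_{\mathfrak u}g_n=1$ and $g_nx_n=x_n'$ for $\mathfrak u$-almost every $n$. The class of $(x_n)_n$ is $[x_n]^R_{\mathfrak u}$, $[A_n]_{\mathfrak u}^R$ is the set of classes of sequences with $x_n\in A_n$ for $\mathfrak u$-almost every $n$, and $g[x_n]^R_{\mathfrak u}=[gx_n]^R_{\mathfrak u}$. A sequence of measurable sets $A_n\subset X_n$ is regular if for every $\varepsilon>0$ there is a relatively compact Borel neighborhood $V$ of the identity such that, for $\mathfrak u$-almost every $n$, $VA_n$ is measurable and $\mu_n(VA_n\setminus A_n)\le\varepsilon$. The $\sigma$-algebra of $X_{\mathfrak u}^R$ is generated, up to completion, by the sets $[A_n]^R_{\mathfrak u}$ with $\{A_n\}_n$ regular, and $\mu_{\mathfrak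 u}^R$ is the push-forward of $\mu_{\mathfrak u}$ under $X_{\mathfrak u}\to X_{\mathfrak u}^R$. Theorem. The $G$-invariant set $Z:=G[\Phi_n(U\times Y_n)]^R_{\mathfrak u}\subset X^R_{\mathfrak u}$ is measurable and of positive measure, the limit $c:=\lim_{\mathfrak u}\operatorname{covol}(Y_n)$ exists in $(0,\infty)$, and $(Y_{\mathfrak u},\nu_{\mathfrak u})$ with the map $$\Psi:G\times Y_{\mathfrak u}\to Z,\qquad \Psi(g,[y_n]_{\mathfrak u})=[gy_n]^R_{\mathfrak u},$$ is an external $U$-cross section of the action of $G$ on $Z$ with the normalized measure $\mu_Z:=\mu^R_{\mathfrak u}|_Z/\mu^R_{\mathfrak u}(Z)$, of covolume $c\,\mu_{\mathfrak u}^R(Z)$. That is: $G$ acts on the probability space $(Z,\mu_Z)$ preserving the measure and continuously (for every measurable $A\subset Z$ and $\varepsilon>0$ there is a neighborhood $V$ of the identity with $\mu_Z(A\,\Delta\,gA)\le\varepsilon$ for all $g\in V$); $\Psi$ is measurable and $G$-equivariant; $\Psi(U\times Y_{\mathfrak u})$ is measurable; $\Psi$ restricts to a bijective measurable isomorphism from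 $U\times Y_{\mathfrak u}$ onto $\Psi(U\times Y_{\mathfrak u})$ carrying $\lambda\times\nu_{\mathfrak u}$ to $c\,\mu_{\mathfrak u}^R(Z)\,\mu_Z=c\,\mu^R_{\mathfrak u}|_Z$; and $\Psi(G\times Y_{\mathfrak u})$ is measurable and of full measure in $Z$. -/

import Mathlib

open MeasureTheory Set Filter Topology
open scoped ENNReal Pointwise

namespace CrossUltra

noncomputable section

/-! ### Set-theoretic ultraproducts and Loeb measures -/

/-- The ultraproduct `[X_n]_u` of a sequence of sets: sequences modulo equality for `u`-almost
every `n`. -/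
def Ultraproduct (u : Ultrafilter ℕ) (X : ℕ → Type*) : Type _ :=
  Filter.Product (u : Filter ℕ) X

namespace Ultraproduct

variable {u : Ultrafilter ℕ} {X : ℕ → Type*}

/-- The class `[x_n]_u` of a sequence of points. -/
def mk (u : Ultrafilter ℕ) {X : ℕ → Type*} (x : ∀ n, X n) : Ultraproduct u X :=
  Quotient.mk _ x

theorem mk_eq_mk {x y : ∀ n, X n} : mk u x = mk u y ↔ ∀ᶠ n in u, x n = y n :=
  Quotient.eq

theorem exists_mk (p : Ultraproduct u X) : ∃ x, mk u x = p := Quotient.exists_rep p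

end Ultraproduct

/-- The class `[A_n]_u` of a sequence of subsets `A_n ⊆ X_n`, as a subset of `[X_n]_u`. -/
def internalSet (u : Ultrafilter ℕ) {X : ℕ → Type*} (A : ∀ n, Set (X n)) :
    Set (Ultraproduct u X) :=
  {p | ∃ x : ∀ n, X n, Ultraproduct.mk u x = p ∧ ∀ᶠ n in u, x n ∈ A n}

theorem mk_mem_internalSet {u : Ultrafilter ℕ} {X : ℕ → Type*} {A : ∀ n, Set (X n)}
    {x : ∀ n, X n} : Ultraproduct.mk u x ∈ internalSet u A ↔ ∀ᶠ n in u, x n ∈ A n := by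
  constructor
  · rintro ⟨y, hy, hA⟩
    filter_upwards [Ultraproduct.mk_eq_mk.1 hy, hA] with n h1 h2
    exact h1 ▸ h2
  · exact fun h => ⟨x, rfl, h⟩

/-- The σ-algebra on `[X_n]_u` generated by the classes of sequences of measurable sets. -/
instance (u : Ultrafilter ℕ) (X : ℕ → Type*) [∀ n, MeasurableSpace (X n)] :
    MeasurableSpace (Ultraproduct u X) :=
  MeasurableSpace.generateFrom
    {S | ∃ A : ∀ n, Set (X n), (∀ n, MeasurableSet (A n)) ∧ S = internalSet u A}

/-- The least value of `lim_u μ_n(A_n)` over the sequences of measurable sets `A_n` with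
`S ⊆ [A_n]_u`. -/
def loebContent (u : Ultrafilter ℕ) {X : ℕ → Type*} [∀ n, MeasurableSpace (X n)]
    (μ : ∀ n, Measure (X n)) (S : Set (Ultraproduct u X)) : ℝ≥0∞ :=
  ⨅ (A : ∀ n, Set (X n)) (_ : ∀ n, MeasurableSet (A n)) (_ : S ⊆ internalSet u A),
    limUnder (u : Filter ℕ) (fun n => μ n (A n))

section Loeb

variable {u : Ultrafilter ℕ} {X : ℕ → Type*} [∀ n, MeasurableSpace (X n)]
  {μ : ∀ n, Measure (X n)}

theorem tendsto_ulim (f : ℕ → ℝ≥0∞) : Tendsto f u (𝓝 (limUnder (u : Filter ℕ) f)) := by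
  refine tendsto_nhds_limUnder ?_
  obtain ⟨x, -, hx⟩ := isCompact_univ.ultrafilter_le_nhds (u.map f) (by simp)
  exact ⟨x, hx⟩

theorem loebContent_empty : loebContent u μ ∅ = 0 := by
  refine le_antisymm ?_ zero_le
  refine (iInf_le_of_le (fun _ => ∅) (iInf_le_of_le (fun _ => MeasurableSet.empty)
    (iInf_le_of_le (empty_subset _) ?_)))
  simp only [measure_empty]
  exact (tendsto_const_nhds.limUnder_eq).le

/-- The outer measure on `[X_n]_u` induced by the internal sets. -/
def loebOuterMeasure (u : Ultrafilter ℕ) {X : ℕ → Type*} [∀ n, MeasurableSpace (X n)]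
    (μ : ∀ n, Measure (X n)) : OuterMeasure (Ultraproduct u X) :=
  OuterMeasure.ofFunction (loebContent u μ) loebContent_empty

theorem le_caratheodory_loebOuterMeasure :
    (inferInstance : MeasurableSpace (Ultraproduct u X)) ≤
      (loebOuterMeasure u μ).caratheodory := by
  refine MeasurableSpace.generateFrom_le ?_
  rintro _ ⟨B, hB, rfl⟩
  refine OuterMeasure.ofFunction_caratheodory fun t => ?_
  refine le_iInf fun A => le_iInf fun hA => le_iInf fun htA => ?_
  have h1 : loebContent u μ (t ∩ internalSet u B) ≤
      limUnder (u : Filter ℕ) (fun n => μ n (A n ∩ B n)) := by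
    refine iInf_le_of_le (fun n => A n ∩ B n) (iInf_le_of_le (fun n => (hA n).inter (hB n))
      (iInf_le_of_le ?_ le_rfl))
    rintro p ⟨hp, hpB⟩
    obtain ⟨x, rfl⟩ := Ultraproduct.exists_mk p
    exact mk_mem_internalSet.2
      ((mk_mem_internalSet.1 (htA hp)).and (mk_mem_internalSet.1 hpB))
  have h2 : loebContent u μ (t \ internalSet u B) ≤
      limUnder (u : Filter ℕ) (fun n => μ n (A n \ B n)) := by
    refine iInf_le_of_le (fun n => A n \ B n) (iInf_le_of_le (fun n => (hA n).diff (hB n))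
      (iInf_le_of_le ?_ le_rfl))
    rintro p ⟨hp, hpB⟩
    obtain ⟨x, rfl⟩ := Ultraproduct.exists_mk p
    exact mk_mem_internalSet.2 ((mk_mem_internalSet.1 (htA hp)).and
      (Ultrafilter.eventually_not.2 (fun h => hpB (mk_mem_internalSet.2 h))))
  refine (add_le_add h1 h2).trans (le_of_eq ?_)
  have h3 := (tendsto_ulim (u := u) (fun n => μ n (A n ∩ B n))).add
    (tendsto_ulim (u := u) (fun n => μ n (A n \ B n)))
  refine (tendsto_nhds_unique h3 ?_)
  simpa only [measure_inter_add_sdiff _ (hB _)] using tendsto_ulim (u := u) (fun n => μ n (A n))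

end Loeb

/-- The Loeb measure `μ_u` on `[X_n]_u`: the measure with `μ_u([A_n]_u) = lim_u μ_n(A_n)`.
The σ-algebra of the Loeb space is the completion, that is, its members are the sets `S` with
`NullMeasurableSet S (loebMeasure u μ)`. -/
def loebMeasure (u : Ultrafilter ℕ) {X : ℕ → Type*} [∀ n, MeasurableSpace (X n)]
    (μ : ∀ n, Measure (X n)) : Measure (Ultraproduct u X) :=
  (loebOuterMeasure u μ).toMeasure le_caratheodory_loebOuterMeasure

/-! ### The regular ultraproduct -/

/-- A neighborhood of the identity: a relatively compact Borel set containing an open set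
containing the identity. -/
def IsIdNhd {G : Type*} [Group G] [TopologicalSpace G] [MeasurableSpace G] (V : Set G) : Prop :=
  MeasurableSet V ∧ V ∈ 𝓝 (1 : G) ∧ ∃ K, IsCompact K ∧ V ⊆ K

/-- `(x_n) ∼ (y_n)` if there are `g_n ∈ G` with `lim_u g_n = 1` and `g_n x_n = y_n` for
`u`-almost every `n`. -/
def regSetoid (G : Type*) [Group G] [TopologicalSpace G] [IsTopologicalGroup G]
    (u : Ultrafilter ℕ) (X : ℕ → Type*) [∀ n, MulAction G (X n)] : Setoid (∀ n, X n) where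
  r x y := ∃ g : ℕ → G, Tendsto g u (𝓝 1) ∧ ∀ᶠ n in u, g n • x n = y n
  iseqv :=
    { refl := fun _ => ⟨fun _ => 1, tendsto_const_nhds, by simp⟩
      symm := by
        rintro x y ⟨g, hg, h⟩
        refine ⟨fun n => (g n)⁻¹, by simpa using hg.inv, ?_⟩
        filter_upwards [h] with n hn
        rw [← hn, inv_smul_smul]
      trans := by
        rintro x y z ⟨g, hg, h⟩ ⟨k, hk, h'⟩
        refine ⟨fun n => k n * g n, by simpa using hk.mul hg, ?_⟩
        filter_upwards [h, h'] with n hn hn'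
        rw [mul_smul, hn, hn'] }

/-- The underlying set `[X_n]_u^R` of the regular ultraproduct of the `G`-spaces `(X_n, μ_n)`.
The measures are recorded in the type because the σ-algebra depends on them. -/
def RegUltraproduct (G : Type*) [Group G] [TopologicalSpace G] [IsTopologicalGroup G]
    (u : Ultrafilter ℕ) {X : ℕ → Type*} [∀ n, MeasurableSpace (X n)] [∀ n, MulAction G (X n)]
    (_μ : ∀ n, Measure (X n)) : Type _ :=
  Quotient (regSetoid G u X)

section Regular

variable (G : Type*) [Group G] [TopologicalSpace G] [IsTopologicalGroup G]
  (u : Ultrafilter ℕ) {X : ℕ → Type*} [∀ n, MeasurableSpace (X n)] [∀ n, MulAction G (X n)]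
  (μ : ∀ n, Measure (X n))

/-- The class `[x_n]_u^R`. -/
def RegUltraproduct.mk (x : ∀ n, X n) : RegUltraproduct G u μ :=
  Quotient.mk (regSetoid G u X) x

variable {G u μ} in
theorem RegUltraproduct.mk_eq_mk {x y : ∀ n, X n} :
    RegUltraproduct.mk G u μ x = RegUltraproduct.mk G u μ y ↔
      ∃ g : ℕ → G, Tendsto g u (𝓝 1) ∧ ∀ᶠ n in u, g n • x n = y n :=
  Quotient.eq (r := regSetoid G u X)

/-- The action `g [x_n]_u^R = [g x_n]_u^R`. -/
instance : MulAction G (RegUltraproduct G u μ) where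
  smul g := Quotient.map (sa := regSetoid G u X) (sb := regSetoid G u X)
    (fun x n => g • x n) (by
      rintro x y ⟨k, hk, h⟩
      refine ⟨fun n => g * k n * g⁻¹, ?_, ?_⟩
      · simpa using (tendsto_const_nhds (x := g)).mul hk |>.mul (tendsto_const_nhds (x := g⁻¹))
      · filter_upwards [h] with n hn
        rw [mul_smul, mul_smul, inv_smul_smul, hn])
  one_smul := by
    rintro ⟨x⟩
    exact congrArg (RegUltraproduct.mk G u μ) (funext fun n => one_smul G (x n))
  mul_smul := by
    rintro g h ⟨x⟩
    exact congrArg (RegUltraproduct.mk G u μ) (funext fun n => mul_smul g h (x n))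

/-- The quotient map `[x_n]_u ↦ [x_n]_u^R`. -/
def regProj : Ultraproduct u X → RegUltraproduct G u μ :=
  Quotient.lift (RegUltraproduct.mk G u μ) fun _ _ h =>
    RegUltraproduct.mk_eq_mk.2
      ⟨fun _ => 1, tendsto_const_nhds, Eventually.mono h fun n hn => by
        rw [one_smul]
        exact hn⟩

/-- The subset `[A_n]_u^R` of the regular ultraproduct. -/
def regSet (A : ∀ n, Set (X n)) : Set (RegUltraproduct G u μ) :=
  regProj G u μ '' internalSet u A

variable [MeasurableSpace G]

/-- Regular sequences of (measurable) subsets. Here `V • A n` is the set of all `g • x` with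
`g ∈ V`, `x ∈ A n`, and the measurable subsets of the complete space `(X_n, μ_n)` are the
null-measurable ones. -/
def IsRegularSeq (A : ∀ n, Set (X n)) : Prop :=
  (∀ᶠ n in u, NullMeasurableSet (A n) (μ n)) ∧
  ∀ ε : ℝ≥0∞, 0 < ε → ∃ V : Set G, IsIdNhd V ∧
    (∀ᶠ n in u, NullMeasurableSet (V • A n) (μ n)) ∧
    ∀ᶠ n in u, μ n ((V • A n) \ A n) ≤ ε

/-- The σ-algebra generated by the regular subsets. -/
instance : MeasurableSpace (RegUltraproduct G u μ) :=
  MeasurableSpace.generateFrom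
    {S | ∃ A : ∀ n, Set (X n), IsRegularSeq G u μ A ∧ S = regSet G u μ A}

/-- The measure `μ_u^R` of the regular ultraproduct: the push-forward of the (completed) Loeb
measure under the quotient map, which is measurable (see `measurable_regProj`). The σ-algebra
of the regular ultraproduct is the completion, that is, its members are the sets `S` with
`NullMeasurableSet S (regMeasure G u μ)`. -/
def regMeasure : Measure (RegUltraproduct G u μ) :=
  Measure.map
    (fun p : NullMeasurableSpace (Ultraproduct u X) (loebMeasure u μ) => regProj G u μ p)
    (loebMeasure u μ).completion

variable {u μ} in
theorem loebMeasure_internalSet_le (A : ∀ n, Set (X n)) {ε : ℝ≥0∞}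
    (h : ∀ᶠ n in u, μ n (A n) ≤ ε) : loebMeasure u μ (internalSet u A) ≤ ε := by
  have hsub : internalSet u A ⊆ internalSet u (fun n => toMeasurable (μ n) (A n)) := by
    rintro p ⟨x, rfl, hx⟩
    exact mk_mem_internalSet.2 (hx.mono fun n hn => subset_toMeasurable _ _ hn)
  refine (measure_mono hsub).trans ?_
  have hm : MeasurableSet (internalSet u (fun n => toMeasurable (μ n) (A n))) :=
    MeasurableSpace.measurableSet_generateFrom ⟨_, fun n => measurableSet_toMeasurable _ _, rfl⟩
  rw [loebMeasure, toMeasure_apply _ _ hm]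
  refine (OuterMeasure.ofFunction_le _).trans ?_
  refine iInf_le_of_le _ (iInf_le_of_le (fun n => measurableSet_toMeasurable _ _)
      (iInf_le_of_le subset_rfl ?_))
  refine le_of_tendsto (tendsto_ulim _) ?_
  simpa only [measure_toMeasurable] using h

variable {u μ} in
theorem nullMeasurableSet_internalSet (A : ∀ n, Set (X n))
    (h : ∀ᶠ n in u, NullMeasurableSet (A n) (μ n)) :
    NullMeasurableSet (internalSet u A) (loebMeasure u μ) := by
  classical
  let B : ∀ n, Set (X n) := fun n =>
    if hn : NullMeasurableSet (A n) (μ n) then toMeasurable (μ n) (A n) else ∅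
  have hB : MeasurableSet (internalSet u B) := by
    refine MeasurableSpace.measurableSet_generateFrom ⟨B, fun n => ?_, rfl⟩
    by_cases hn : NullMeasurableSet (A n) (μ n)
    · simp only [B, hn, dif_pos, measurableSet_toMeasurable]
    · simp only [B, hn, dif_neg, not_false_eq_true, MeasurableSet.empty]
  have hle : internalSet u A ⊆ internalSet u B := by
    rintro p ⟨x, rfl, hx⟩
    refine mk_mem_internalSet.2 ?_
    filter_upwards [hx, h] with n h1 h2
    simp only [B, h2, dif_pos]
    exact subset_toMeasurable _ _ h1
  have hnull : loebMeasure u μ (internalSet u B \ internalSet u A) = 0 := by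
    refine le_antisymm ?_ zero_le
    refine (measure_mono ?_).trans
      (loebMeasure_internalSet_le (u := u) (μ := μ) (fun n => B n \ A n) ?_)
    · rintro p ⟨hp, hpA⟩
      obtain ⟨x, rfl⟩ := Ultraproduct.exists_mk p
      exact mk_mem_internalSet.2 ((mk_mem_internalSet.1 hp).and
        (Ultrafilter.eventually_not.2 (fun h => hpA (mk_mem_internalSet.2 h))))
    · filter_upwards [h] with n hn
      simp only [B, hn, dif_pos]
      exact (ae_le_set.1 hn.toMeasurable_ae_eq.le).le
  have : internalSet u A = internalSet u B \ (internalSet u B \ internalSet u A) := by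
    rw [sdiff_sdiff_right_self]
    exact (inter_eq_right.2 hle).symm
  rw [this]
  exact hB.nullMeasurableSet.diff (NullMeasurableSet.of_null hnull)

/-- The quotient map from the complete Loeb space to the regular ultraproduct is measurable. -/
theorem measurable_regProj :
    Measurable[(inferInstance :
      MeasurableSpace (NullMeasurableSpace (Ultraproduct u X) (loebMeasure u μ)))]
      (regProj G u μ) := by
  refine @measurable_generateFrom _ _ (inferInstance :
      MeasurableSpace (NullMeasurableSpace (Ultraproduct u X) (loebMeasure u μ))) _ _ ?_
  rintro _ ⟨A, ⟨hA, hreg⟩, rfl⟩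
  change NullMeasurableSet (regProj G u μ ⁻¹' regSet G u μ A) (loebMeasure u μ)
  have hsub : internalSet u A ⊆ regProj G u μ ⁻¹' regSet G u μ A := subset_preimage_image _ _
  have hnull : loebMeasure u μ (regProj G u μ ⁻¹' regSet G u μ A \ internalSet u A) = 0 := by
    refine le_antisymm (ENNReal.le_of_forall_pos_le_add fun ε hε _ => ?_) zero_le
    obtain ⟨V, ⟨-, hV, -⟩, -, hle⟩ := hreg ε (by exact_mod_cast hε)
    rw [zero_add]
    refine (measure_mono ?_).trans (loebMeasure_internalSet_le _ hle)
    rintro p ⟨hp, hpA⟩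
    obtain ⟨x, rfl⟩ := Ultraproduct.exists_mk p
    refine mk_mem_internalSet.2 (Eventually.and ?_
      (Ultrafilter.eventually_not.2 (fun h => hpA (mk_mem_internalSet.2 h))))
    obtain ⟨_, ⟨a, rfl, ha⟩, hq⟩ := hp
    obtain ⟨g, hg, hgx⟩ := RegUltraproduct.mk_eq_mk.1 hq
    filter_upwards [ha, hg hV, hgx] with n h1 h2 h3
    exact h3 ▸ Set.smul_mem_smul h2 h1
  rw [← union_sdiff_cancel hsub]
  exact (nullMeasurableSet_internalSet A hA).union (NullMeasurableSet.of_null hnull)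

end Regular

/-! ### Cross sections -/

/-- Borel `U`-cross sections `Y ⊆ X`: the action map is injective on `U × Y` and `G Y` is conull. -/
def IsCrossSection {G X : Type*} [Group G] [MulAction G X] [MeasurableSpace X]
    (U : Set G) (μ : Measure X) (Y : Set X) : Prop :=
  MeasurableSet Y ∧ InjOn (fun p : G × X => p.1 • p.2) (U ×ˢ Y) ∧
    μ ((univ : Set G) • Y)ᶜ = 0

section Transverse

variable {G X : Type*} [Group G] [MeasurableSpace G] [MulAction G X] [MeasurableSpace X]

/-- `ν` is a probability measure on `Y`, `0 < c < ∞`, and `Φ_*(λ|_U × ν) = c μ|_{Φ(U × Y)}`,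
where `Φ(g, y) = g y`. -/
def IsCrossData (lam : Measure G) (U : Set G) (μ : Measure X) (Y : Set X)
    (ν : Measure Y) (c : ℝ) : Prop :=
  IsProbabilityMeasure ν ∧ 0 < c ∧
    Measure.map (fun p : G × Y => p.1 • (p.2 : X)) ((lam.restrict U).prod ν) =
      ENNReal.ofReal c • μ.restrict (U • Y)

/-- The probability measure `ν` and the covolume of a `U`-cross section `Y`: the pair
characterised by `IsCrossData`. -/
def crossData (lam : Measure G) (U : Set G) (μ : Measure X) (Y : Set X) : Measure Y × ℝ :=
  Classical.epsilon fun q => IsCrossData lam U μ Y q.1 q.2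

/-- The probability measure `ν` on a `U`-cross section. -/
def crossMeasure (lam : Measure G) (U : Set G) (μ : Measure X) (Y : Set X) : Measure Y :=
  (crossData lam U μ Y).1

/-- The covolume of a `U`-cross section. -/
def covol (lam : Measure G) (U : Set G) (μ : Measure X) (Y : Set X) : ℝ :=
  (crossData lam U μ Y).2

end Transverse

/-- `G` acts continuously, by measure preserving transformations, on the completion of `(X, μ)`. -/
structure IsContinuousAction (G : Type*) {X : Type*} [Group G] [TopologicalSpace G]
    [MeasurableSpace G] [MulAction G X] [MeasurableSpace X] (μ : Measure X) : Prop where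
  measurable : ∀ (g : G) (A : Set X), NullMeasurableSet A μ →
    NullMeasurableSet ((fun x => g • x) ⁻¹' A) μ
  measure_preimage : ∀ (g : G) (A : Set X), NullMeasurableSet A μ →
    μ ((fun x => g • x) ⁻¹' A) = μ A
  continuous : ∀ A : Set X, NullMeasurableSet A μ → ∀ ε : ℝ≥0∞, 0 < ε →
    ∃ V : Set G, IsIdNhd V ∧ ∀ g ∈ V, μ (symmDiff A (g • A)) ≤ ε

/-- `(Y, ν)` with `Ψ : G × Y → X` is an external `U`-cross section, of covolume `c`, of the
continuous action of `G` on the probability space `(X, μ)`. All spaces are taken with their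
completed σ-algebras, so that "measurable" is null-measurability. -/
structure IsExternalCrossSection {G X Y : Type*} [Group G] [TopologicalSpace G]
    [MeasurableSpace G] [MulAction G X] [MeasurableSpace X] [MeasurableSpace Y]
    (lam : Measure G) (U : Set G) (μ : Measure X) (ν : Measure Y) (Ψ : G × Y → X) (c : ℝ) :
    Prop where
  isProbabilityMeasure : IsProbabilityMeasure μ
  action : IsContinuousAction G μ
  isProbabilityMeasure_section : IsProbabilityMeasure ν
  covol_pos : 0 < c
  equivariant : ∀ (g h : G) (y : Y), Ψ (g * h, y) = g • Ψ (h, y)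
  measurable : ∀ D : Set X, NullMeasurableSet D μ → NullMeasurableSet (Ψ ⁻¹' D) (lam.prod ν)
  measurable_image_univ : NullMeasurableSet (Ψ '' (U ×ˢ univ)) μ
  injOn : InjOn Ψ (U ×ˢ univ)
  measurable_image : ∀ A ⊆ U ×ˢ (univ : Set Y), NullMeasurableSet A (lam.prod ν) →
    NullMeasurableSet (Ψ '' A) μ
  measure_image : ∀ A ⊆ U ×ˢ (univ : Set Y), NullMeasurableSet A (lam.prod ν) →
    lam.prod ν A = ENNReal.ofReal c * μ (Ψ '' A)
  measurable_range : NullMeasurableSet (range Ψ) μ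
  conull : μ (range Ψ)ᶜ = 0

/-! ### Ultraproducts of cross sections -/

section Main

variable (G : Type*) [Group G] [TopologicalSpace G] [IsTopologicalGroup G]
  (u : Ultrafilter ℕ) {X : ℕ → Type*} [∀ n, MeasurableSpace (X n)] [∀ n, MulAction G (X n)]
  (μ : ∀ n, Measure (X n)) (Y : ∀ n, Set (X n))

/-- The map `Ψ(g, [y_n]_u) = [g y_n]_u^R` on `G × Y_u`. -/
def crossMap : G × Ultraproduct u (fun n => Y n) → RegUltraproduct G u μ := fun p =>
  Quotient.lift (fun y : ∀ n, Y n => RegUltraproduct.mk G u μ (fun n => p.1 • (y n : X n)))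
    (fun _ _ h => RegUltraproduct.mk_eq_mk.2
      ⟨fun _ => 1, tendsto_const_nhds, Eventually.mono h fun n hn => by
        rw [one_smul]
        exact congrArg (fun z : Y n => p.1 • (z : X n)) hn⟩) p.2

/-- The `G`-invariant subset `G [Φ_n(U × Y_n)]_u^R` of the regular ultraproduct. -/
def crossSaturation (U : Set G) : SubMulAction G (RegUltraproduct G u μ) where
  carrier := (univ : Set G) • regSet G u μ (fun n => U • Y n)
  smul_mem' := by
    rintro g _ ⟨h, -, x, hx, rfl⟩
    exact ⟨g * h, mem_univ _, x, hx, mul_smul g h x⟩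

/-- The restriction of `μ_u^R` to the invariant subset `G [Φ_n(U × Y_n)]_u^R`, normalized to a
probability measure. -/
def saturationMeasure [MeasurableSpace G] (U : Set G) :
    Measure (crossSaturation G u μ Y U) :=
  (regMeasure G u μ (crossSaturation G u μ Y U : Set (RegUltraproduct G u μ)))⁻¹ •
    (regMeasure G u μ).comap Subtype.val

end Main

end

end CrossUltra

/-!
A cross section `Y` has a transverse measure because, for Borel `A ⊆ Y`, the set function
`B ↦ μ(B A)` on `U'` extends to a left-invariant locally finite measure on `G`, hence is a multiple
of Haar measure (`exists_measure_image_prod_eq_mul`, `exists_isCrossData`). It also follows that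
`λ(U') = covol(Y) μ(U' Y) ≤ covol(Y)`, so that bounded covolumes have a positive finite ultralimit
`c`.

Let `Ψ` be the map `(g, [y_n]) ↦ [g y_n]^R`. It is injective on `U' × Y_u` because `U'` is open
(`injOn_crossMap`). For compact `K ⊆ U'` and Borel `A_n ⊆ Y_n` it maps `K × [A_n]` onto
`[K A_n]^R`, because ultralimits exist in `K` (`image_crossMap_prod_internalSet`), and the sequence
`K A_n` is regular, because `λ(V K \ K)` is small for `V` close to `1`
(`isRegularSeq_image_smul`). In particular the saturation `Z`, which is the range of `Ψ`, is a
countable union of translates of the regular set `[U Y_n]^R`.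

The remaining point is to compare `λ × ν_u`, which lives on a product σ-algebra, with `μ_u^R`, which
comes from the σ-algebra of regular sets. The key is an inequality for arbitrary subsets `S` of the
regular ultraproduct (`measure_preimage_crossMap_le`): the `λ × ν_u`-measure of
`Ψ⁻¹(S) ∩ (U' × Y_u)` is at most `c μ_u^R(S)`. To see it, cover the set of representatives of `S` by
an internal set `[B_n]` of almost the same measure. If `Ψ(g, [y_n]) ∈ S`, then `k_n y_n ∈ B_n`
almost everywhere whenever `k_n → g`; by saturation, a whole neighborhood `O` of `g` satisfies
`O y_n ⊆ B_n` almost everywhere. With `O` from a countable basis this gives a cover by countably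
many measurable rectangles, whose finite unions are controlled by the measures
`covol(Y_n) μ_n(B_n)`.

For `A ⊆ U × Y_u` with null-measurable image, the inequality for `Ψ(A)` and for
`Ψ((U × Y_u) \ A)` adds up to the equality `(λ × ν_u)(U × Y_u) = c μ_u^R(Ψ(U × Y_u))`. So `A` is
null-measurable and the inequality for it is an equality
(`nullMeasurableSet_and_measure_eq_of_image`). This yields measurability and the measure identity
on `U × Y_u`; measurability on all of `G × Y_u` follows by translation, since `G` acts on the
regular ultraproduct continuously and preserving the measure (`isContinuousAction_regMeasure`).
-/

namespace CrossUltra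

/-! ### Ultralimits and Loeb measures -/

/-- Countable saturation, in diagonal form: if each of countably many conditions holds almost
everywhere, then so does the condition of an index `f n` that tends to infinity. Only here is the
ultrafilter required to be non-principal. -/
theorem exists_tendsto_atTop_diagonal {u : Ultrafilter ℕ} (hu : (u : Filter ℕ) ≤ cofinite)
    {p : ℕ → ℕ → Prop} (hp : ∀ j, ∀ᶠ n in u, p j n) :
    ∃ f : ℕ → ℕ, Tendsto f u atTop ∧ ∀ᶠ n in u, p (f n) n := by
  classical
  refine ⟨fun n => Nat.findGreatest (fun j => p j n) n, tendsto_atTop.2 fun m => ?_, ?_⟩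
  · have hm : ∀ᶠ n in u, m ≤ n :=
      (hu.trans Nat.cofinite_eq_atTop.le) (eventually_ge_atTop m)
    filter_upwards [hm, hp m] with n h1 h2
    exact Nat.le_findGreatest h1 h2
  · filter_upwards [hp 0] with n hn
    exact Nat.findGreatest_spec (P := fun j => p j n) (Nat.zero_le n) hn

theorem internalSet_mono {u : Ultrafilter ℕ} {X : ℕ → Type*} {A B : ∀ n, Set (X n)}
    (h : ∀ᶠ n in u, A n ⊆ B n) : internalSet u A ⊆ internalSet u B := by
  rintro p ⟨x, rfl, hx⟩
  exact mk_mem_internalSet.2 (by filter_upwards [hx, h] with n h1 h2 using h2 h1)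

theorem eventually_subset_of_internalSet_subset {u : Ultrafilter ℕ} {X : ℕ → Type*}
    [∀ n, Nonempty (X n)] {A B : ∀ n, Set (X n)}
    (h : internalSet u A ⊆ internalSet u B) : ∀ᶠ n in u, A n ⊆ B n := by
  classical
  by_contra hcon
  have hne : ∀ᶠ n in u, ∃ x, x ∈ A n ∧ x ∉ B n := by
    filter_upwards [Ultrafilter.eventually_not.2 hcon] with n hn
    exact not_subset.1 hn
  have hx : ∃ x : ∀ n, X n, ∀ n, (∃ z, z ∈ A n ∧ z ∉ B n) → x n ∈ A n ∧ x n ∉ B n := by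
    refine Classical.skolem (p := fun n (z : X n) =>
      (∃ z, z ∈ A n ∧ z ∉ B n) → z ∈ A n ∧ z ∉ B n).1 fun n => ?_
    by_cases hn : ∃ z, z ∈ A n ∧ z ∉ B n
    · exact ⟨hn.choose, fun _ => hn.choose_spec⟩
    · exact ⟨Classical.arbitrary _, fun h => absurd h hn⟩
  obtain ⟨x, hx⟩ := hx
  have h1 : Ultraproduct.mk u x ∈ internalSet u A :=
    mk_mem_internalSet.2 (hne.mono fun n hn => (hx n hn).1)
  have h2 := mk_mem_internalSet.1 (h h1)
  obtain ⟨n, hn, hn'⟩ := (h2.and hne).exists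
  exact (hx n hn').2 hn

theorem internalSet_univ {u : Ultrafilter ℕ} {X : ℕ → Type*} :
    internalSet u (fun n => (univ : Set (X n))) = univ := by
  refine eq_univ_of_forall fun p => ?_
  obtain ⟨x, rfl⟩ := Ultraproduct.exists_mk p
  exact mk_mem_internalSet.2 (by simp)

theorem measurableSet_internalSet (u : Ultrafilter ℕ) {X : ℕ → Type*}
    [∀ n, MeasurableSpace (X n)] {A : ∀ n, Set (X n)} (hA : ∀ n, MeasurableSet (A n)) :
    MeasurableSet (internalSet u A) :=
  MeasurableSpace.measurableSet_generateFrom ⟨A, hA, rfl⟩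

section Loeb

variable {u : Ultrafilter ℕ} {X : ℕ → Type*} [∀ n, MeasurableSpace (X n)]
  {μ : ∀ n, Measure (X n)}

/-- Outer regularity of the Loeb measure with respect to internal sets. Saturation turns a
countable cover by internal sets into a single one. -/
theorem exists_internalSet_superset (hu : (u : Filter ℕ) ≤ cofinite)
    {S : Set (Ultraproduct u X)} {δ : ℝ≥0∞} (hS : loebMeasure u μ S < δ) :
    ∃ B : ∀ n, Set (X n), (∀ n, MeasurableSet (B n)) ∧ S ⊆ internalSet u B ∧
      ∀ᶠ n in u, μ n (B n) < δ := by
  have hT := measurableSet_toMeasurable (loebMeasure u μ) S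
  rw [← measure_toMeasurable S] at hS
  have hST := subset_toMeasurable (loebMeasure u μ) S
  generalize toMeasurable (loebMeasure u μ) S = T at hT hS hST
  rw [loebMeasure, toMeasure_apply _ _ hT, loebOuterMeasure, OuterMeasure.ofFunction_apply] at hS
  simp only [iInf_lt_iff] at hS
  obtain ⟨t, ht, hsum⟩ := hS
  have hfin : ∀ k, loebContent u μ (t k) ≠ ∞ :=
    ENNReal.ne_top_of_tsum_ne_top (hsum.trans_le le_top).ne
  obtain ⟨ε, hε, hεsum⟩ := ENNReal.exists_pos_sum_of_countable'
    (tsub_pos_iff_lt.2 hsum).ne' ℕ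
  have hlt : ∀ k, loebContent u μ (t k) < loebContent u μ (t k) + ε k := fun k =>
    ENNReal.lt_add_right (hfin k) (hε k).ne'
  have hA : ∀ k, ∃ A : ∀ n, Set (X n), (∀ n, MeasurableSet (A n)) ∧ t k ⊆ internalSet u A ∧
      limUnder (u : Filter ℕ) (fun n => μ n (A n)) < loebContent u μ (t k) + ε k := by
    intro k
    have := hlt k
    conv_lhs at this => rw [loebContent]
    simp only [iInf_lt_iff] at this
    obtain ⟨A, h1, h2, h3⟩ := this
    exact ⟨A, h1, h2, h3⟩
  choose A hAm htA hAlt using hA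
  have hev : ∀ K : ℕ, ∀ᶠ n in u, μ n (⋃ k ∈ Finset.range K, A k n) < δ := by
    intro K
    have hlim : Tendsto (fun n => ∑ k ∈ Finset.range K, μ n (A k n)) u
        (𝓝 (∑ k ∈ Finset.range K, limUnder (u : Filter ℕ) (fun n => μ n (A k n)))) :=
      tendsto_finsetSum _ fun k _ => tendsto_ulim _
    have hlt : ∑ k ∈ Finset.range K, limUnder (u : Filter ℕ) (fun n => μ n (A k n)) < δ := by
      calc _ ≤ ∑ k ∈ Finset.range K, (loebContent u μ (t k) + ε k) :=
            Finset.sum_le_sum fun k _ => (hAlt k).le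
        _ ≤ ∑' k, (loebContent u μ (t k) + ε k) := ENNReal.sum_le_tsum _
        _ = (∑' k, loebContent u μ (t k)) + ∑' k, ε k := ENNReal.tsum_add
        _ < δ := by
            rw [add_comm]
            exact lt_tsub_iff_right.1 hεsum
    filter_upwards [hlim.eventually_lt_const hlt] with n hn
    exact (measure_biUnion_finset_le _ _).trans_lt hn
  obtain ⟨f, hf, hfn⟩ := exists_tendsto_atTop_diagonal hu hev
  classical
  refine ⟨fun n => ⋃ k ∈ Finset.range (f n), A k n,
    fun n => Finset.measurableSet_biUnion _ fun k _ => hAm k n, fun p hp => ?_, hfn⟩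
  obtain ⟨k, hk⟩ := mem_iUnion.1 (ht (hST hp))
  refine internalSet_mono ?_ (htA k hk)
  filter_upwards [hf.eventually_gt_atTop k] with n hn
  exact subset_biUnion_of_mem (u := fun k => A k n) (Finset.mem_coe.2 (Finset.mem_range.2 hn))

theorem tendsto_loebMeasure_internalSet (hu : (u : Filter ℕ) ≤ cofinite)
    [∀ n, IsProbabilityMeasure (μ n)] {A : ∀ n, Set (X n)} (hA : ∀ n, MeasurableSet (A n)) :
    Tendsto (fun n => μ n (A n)) u (𝓝 (loebMeasure u μ (internalSet u A))) := by
  have : ∀ n, Nonempty (X n) := fun n => nonempty_of_isProbabilityMeasure (μ n)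
  have h := tendsto_ulim (u := u) (fun n => μ n (A n))
  suffices loebMeasure u μ (internalSet u A) = limUnder (u : Filter ℕ) (fun n => μ n (A n)) by
    rwa [this]
  apply le_antisymm
  · rw [loebMeasure, toMeasure_apply _ _ (measurableSet_internalSet u hA)]
    exact (OuterMeasure.ofFunction_le _).trans
      (iInf_le_of_le _ (iInf_le_of_le hA (iInf_le_of_le subset_rfl le_rfl)))
  · refine le_of_forall_gt fun δ hδ => ?_
    obtain ⟨δ', hδ', hδ'δ⟩ := exists_between hδ
    obtain ⟨B, -, hAB, hlt⟩ := exists_internalSet_superset hu hδ'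
    refine (le_of_tendsto h ?_).trans_lt hδ'δ
    filter_upwards [eventually_subset_of_internalSet_subset hAB, hlt] with n h1 h2
    exact (measure_mono h1).trans h2.le

theorem isProbabilityMeasure_loebMeasure (hu : (u : Filter ℕ) ≤ cofinite)
    [∀ n, IsProbabilityMeasure (μ n)] : IsProbabilityMeasure (loebMeasure u μ) := by
  refine ⟨tendsto_nhds_unique ?_ (tendsto_const_nhds (x := (1 : ℝ≥0∞)) (f := (u : Filter ℕ)))⟩
  have := tendsto_loebMeasure_internalSet (μ := μ) hu (fun n => MeasurableSet.univ)
  simpa [internalSet_univ] using this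

end Loeb

/-! ### The measure and the action on the regular ultraproduct -/

section Regular

variable {G : Type*} [Group G] [TopologicalSpace G] [IsTopologicalGroup G]
  {u : Ultrafilter ℕ} {X : ℕ → Type*} [∀ n, MeasurableSpace (X n)] [∀ n, MulAction G (X n)]
  {μ : ∀ n, Measure (X n)}

theorem smul_regSet (g : G) (A : ∀ n, Set (X n)) :
    g • regSet G u μ A = regSet G u μ fun n => g • A n := by
  ext p
  constructor
  · rintro ⟨_, ⟨_, ⟨x, rfl, hx⟩, rfl⟩, rfl⟩
    exact ⟨Ultraproduct.mk u fun n => g • x n, mk_mem_internalSet.2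
      (hx.mono fun n hn => smul_mem_smul_set hn), rfl⟩
  · rintro ⟨_, ⟨x, rfl, hx⟩, rfl⟩
    refine ⟨RegUltraproduct.mk G u μ fun n => g⁻¹ • x n,
      ⟨Ultraproduct.mk u fun n => g⁻¹ • x n, mk_mem_internalSet.2
        (hx.mono fun n hn => mem_smul_set_iff_inv_smul_mem.1 hn), rfl⟩, ?_⟩
    change RegUltraproduct.mk G u μ (fun n => g • g⁻¹ • x n) = RegUltraproduct.mk G u μ x
    simp

theorem eventually_mem_smul_of_mem_regSet {A : ∀ n, Set (X n)} {x : ∀ n, X n}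
    (hx : RegUltraproduct.mk G u μ x ∈ regSet G u μ A) {V : Set G} (hV : V ∈ 𝓝 (1 : G)) :
    ∀ᶠ n in u, x n ∈ V • A n := by
  obtain ⟨_, ⟨a, rfl, ha⟩, hq⟩ := hx
  obtain ⟨g, hg, hgx⟩ := RegUltraproduct.mk_eq_mk.1 hq
  filter_upwards [ha, hg hV, hgx] with n h1 h2 h3
  exact h3 ▸ Set.smul_mem_smul h2 h1

variable [MeasurableSpace G]

theorem regMeasure_apply {S : Set (RegUltraproduct G u μ)} (hS : MeasurableSet S) :
    regMeasure G u μ S = loebMeasure u μ (regProj G u μ ⁻¹' S) := by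
  rw [regMeasure, Measure.map_apply (measurable_regProj G u μ) hS]
  exact Measure.completion_apply _ _

theorem measurableSet_regSet {A : ∀ n, Set (X n)} (hA : IsRegularSeq G u μ A) :
    MeasurableSet (regSet G u μ A) :=
  MeasurableSpace.measurableSet_generateFrom ⟨A, hA, rfl⟩

/-- Every subset of the regular ultraproduct is covered, after pulling back to sequences, by an
internal set of almost the same measure. -/
theorem exists_superset_of_regMeasure_lt (hu : (u : Filter ℕ) ≤ cofinite)
    {S : Set (RegUltraproduct G u μ)} {δ : ℝ≥0∞} (hS : regMeasure G u μ S < δ) :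
    ∃ B : ∀ n, Set (X n), (∀ n, MeasurableSet (B n)) ∧
      (∀ x, RegUltraproduct.mk G u μ x ∈ S → ∀ᶠ n in u, x n ∈ B n) ∧
      ∀ᶠ n in u, μ n (B n) < δ := by
  rw [← measure_toMeasurable, regMeasure_apply (measurableSet_toMeasurable _ _)] at hS
  obtain ⟨B, hB, hSB, hlt⟩ := exists_internalSet_superset hu hS
  refine ⟨B, hB, fun x hx => mk_mem_internalSet.1 (hSB ?_), hlt⟩
  exact subset_toMeasurable (regMeasure G u μ) S hx

theorem regMeasure_le_of_superset {S : Set (RegUltraproduct G u μ)} (hS : MeasurableSet S)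
    {B : ∀ n, Set (X n)} {δ : ℝ≥0∞}
    (hSB : ∀ x, RegUltraproduct.mk G u μ x ∈ S → ∀ᶠ n in u, x n ∈ B n)
    (hlt : ∀ᶠ n in u, μ n (B n) ≤ δ) : regMeasure G u μ S ≤ δ := by
  rw [regMeasure_apply hS]
  refine (measure_mono ?_).trans (loebMeasure_internalSet_le B hlt)
  intro p hp
  obtain ⟨x, rfl⟩ := Ultraproduct.exists_mk p
  exact mk_mem_internalSet.2 (hSB x hp)

theorem tendsto_regMeasure_regSet (hu : (u : Filter ℕ) ≤ cofinite)
    [∀ n, IsProbabilityMeasure (μ n)] {A : ∀ n, Set (X n)} (hA : IsRegularSeq G u μ A)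
    (hAm : ∀ n, MeasurableSet (A n)) :
    Tendsto (fun n => μ n (A n)) u (𝓝 (regMeasure G u μ (regSet G u μ A))) := by
  suffices regMeasure G u μ (regSet G u μ A) = loebMeasure u μ (internalSet u A) by
    rw [this]; exact tendsto_loebMeasure_internalSet hu hAm
  rw [regMeasure_apply (measurableSet_regSet hA)]
  refine le_antisymm (ENNReal.le_of_forall_pos_le_add fun ε hε _ => ?_)
    (measure_mono (subset_preimage_image _ _))
  obtain ⟨V, ⟨-, hV, -⟩, -, hle⟩ := hA.2 ε (by exact_mod_cast hε)
  refine (measure_mono (t := internalSet u A ∪ internalSet u fun n => (V • A n) \ A n) ?_).trans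
    ((measure_union_le _ _).trans (add_le_add_right (loebMeasure_internalSet_le _ hle) _))
  intro p hp
  obtain ⟨x, rfl⟩ := Ultraproduct.exists_mk p
  by_cases hpA : Ultraproduct.mk u x ∈ internalSet u A
  · exact Or.inl hpA
  · refine Or.inr (mk_mem_internalSet.2
      ((eventually_mem_smul_of_mem_regSet hp hV).and
        (Ultrafilter.eventually_not.2 (fun h => hpA (mk_mem_internalSet.2 h)))))

theorem isProbabilityMeasure_regMeasure (hu : (u : Filter ℕ) ≤ cofinite)
    [∀ n, IsProbabilityMeasure (μ n)] : IsProbabilityMeasure (regMeasure G u μ) := by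
  have := isProbabilityMeasure_loebMeasure (μ := μ) hu
  exact ⟨by rw [regMeasure_apply MeasurableSet.univ, preimage_univ, measure_univ]⟩

variable [BorelSpace G] [∀ n, MeasurableSMul₂ G (X n)] [∀ n, SMulInvariantMeasure G (X n) (μ n)]

theorem IsRegularSeq.smul {A : ∀ n, Set (X n)} (hA : IsRegularSeq G u μ A) (g : G) :
    IsRegularSeq G u μ fun n => g • A n := by
  refine ⟨hA.1.mono fun n hn => hn.smul g, fun ε hε => ?_⟩
  obtain ⟨V, ⟨hVm, hV, K, hK, hVK⟩, hVn, hle⟩ := hA.2 ε hε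
  have hcont : Continuous fun h : G => g⁻¹ * h * g := by fun_prop
  have hcont' : Continuous fun h : G => g * h * g⁻¹ := by fun_prop
  have heq : ∀ n, ((fun h : G => g⁻¹ * h * g) ⁻¹' V) • g • A n = g • V • A n := by
    intro n
    ext x
    constructor
    · rintro ⟨h, hh, _, ⟨a, ha, rfl⟩, rfl⟩
      refine ⟨(g⁻¹ * h * g) • a, smul_mem_smul hh ha, ?_⟩
      simp [smul_smul, mul_assoc]
    · rintro ⟨_, ⟨h, hh, a, ha, rfl⟩, rfl⟩
      refine ⟨g * h * g⁻¹, by simpa [mul_assoc] using hh, g • a, smul_mem_smul_set ha, ?_⟩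
      simp [smul_smul, mul_assoc]
  refine ⟨(fun h : G => g⁻¹ * h * g) ⁻¹' V, ⟨hcont.measurable hVm,
    hcont.continuousAt.preimage_mem_nhds (by simpa using hV), _, hK.image hcont', ?_⟩, ?_, ?_⟩
  · intro h hh
    exact ⟨_, hVK hh, by simp [mul_assoc]⟩
  · simp only [heq]
    exact hVn.mono fun n hn => hn.smul g
  · filter_upwards [hle] with n hn
    rw [heq, ← smul_set_sdiff, measure_smul]
    exact hn

theorem measurableConstSMul_regUltraproduct :
    MeasurableConstSMul G (RegUltraproduct G u μ) := by
  refine ⟨fun g => measurable_generateFrom ?_⟩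
  rintro _ ⟨A, hA, rfl⟩
  rw [preimage_smul, smul_regSet]
  exact measurableSet_regSet (hA.smul _)

/-- Translation maps internal covers to internal covers of the same measure, so no translation
increases the measure. -/
theorem smulInvariantMeasure_regMeasure (hu : (u : Filter ℕ) ≤ cofinite) :
    SMulInvariantMeasure G (RegUltraproduct G u μ) (regMeasure G u μ) := by
  have := measurableConstSMul_regUltraproduct (G := G) (u := u) (μ := μ)
  have key : ∀ (g : G) {S : Set (RegUltraproduct G u μ)}, MeasurableSet S →
      regMeasure G u μ ((fun x => g • x) ⁻¹' S) ≤ regMeasure G u μ S := by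
    intro g S hS
    refine le_of_forall_gt fun δ hδ => ?_
    obtain ⟨δ', hδ', hδ'δ⟩ := exists_between hδ
    obtain ⟨B, -, hSB, hlt⟩ := exists_superset_of_regMeasure_lt hu hδ'
    refine (regMeasure_le_of_superset (B := fun n => (fun x => g • x) ⁻¹' B n) (δ := δ')
      (measurable_const_smul g hS) (fun x hx => hSB _ hx) ?_).trans_lt hδ'δ
    filter_upwards [hlt] with n hn
    rw [measure_preimage_smul]
    exact hn.le
  refine ⟨fun g S hS => (key g hS).antisymm ?_⟩
  have := key g⁻¹ (measurable_const_smul g hS)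
  rwa [← preimage_comp, show (fun x : RegUltraproduct G u μ => g • x) ∘ (fun x => g⁻¹ • x) = id
    from funext fun x => smul_inv_smul g x, preimage_id] at this

/-- The action on the regular ultraproduct is continuous: this holds for the generating sets by
definition of regularity, and passes to complements and countable unions. -/
theorem exists_nhds_regMeasure_symmDiff_le (hu : (u : Filter ℕ) ≤ cofinite)
    [∀ n, IsProbabilityMeasure (μ n)] {S : Set (RegUltraproduct G u μ)}
    (hS : MeasurableSet S) :
    ∀ ε : ℝ≥0∞, 0 < ε → ∃ V ∈ 𝓝 (1 : G), ∀ g ∈ V,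
      regMeasure G u μ (symmDiff S (g • S)) ≤ ε := by
  have := measurableConstSMul_regUltraproduct (G := G) (u := u) (μ := μ)
  have := smulInvariantMeasure_regMeasure (G := G) (μ := μ) hu
  have := isProbabilityMeasure_regMeasure (G := G) (μ := μ) hu
  induction S, hS using MeasurableSpace.generateFrom_induction with
  | hC S hS _ =>
    obtain ⟨A, hA, rfl⟩ := hS
    intro ε hε
    obtain ⟨V, ⟨-, hV, -⟩, -, hle⟩ := hA.2 (ε / 2) (ENNReal.half_pos hε.ne')
    obtain ⟨W, hW, hWV⟩ := exists_nhds_one_split hV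
    have key : ∀ g ∈ W, regMeasure G u μ ((g • regSet G u μ A) \ regSet G u μ A) ≤ ε / 2 := by
      intro g hg
      have hm := measurableSet_regSet hA
      refine regMeasure_le_of_superset (B := fun n => (V • A n) \ A n)
        ((hm.const_smul g).diff hm) ?_ hle
      rintro x ⟨hx1, hx2⟩
      refine Eventually.and ?_ (Ultrafilter.eventually_not.2 fun h =>
        hx2 ⟨_, mk_mem_internalSet.2 h, rfl⟩)
      rw [smul_regSet] at hx1
      filter_upwards [eventually_mem_smul_of_mem_regSet hx1 hW] with n hn
      obtain ⟨w, hw, _, ⟨a, ha, rfl⟩, hwx⟩ := hn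
      exact ⟨w * g, hWV w hw g hg, a, ha, (mul_smul w g a).trans hwx⟩
    refine ⟨W ∩ W⁻¹, inter_mem hW (inv_mem_nhds_one G hW), fun g hg => ?_⟩
    rw [Set.symmDiff_def]
    refine (measure_union_le _ _).trans ((add_le_add ?_ (key g hg.1)).trans
      (ENNReal.add_halves ε).le)
    have h2 := key g⁻¹ hg.2
    rwa [← measure_smul _ g, smul_set_sdiff, smul_inv_smul] at h2
  | empty => exact fun ε _ => ⟨univ, univ_mem, fun g _ => by simp⟩
  | compl S _ ih =>
    intro ε hε
    obtain ⟨V, hV, h⟩ := ih ε hε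
    refine ⟨V, hV, fun g hg => ?_⟩
    rw [smul_set_compl, compl_symmDiff_compl]
    exact h g hg
  | iUnion f hf ih =>
    intro ε hε
    have hmf : ∀ i, MeasurableSet (f i) := hf
    have hε3 : 0 < ε / 3 := ENNReal.div_pos hε.ne' (by norm_num)
    obtain ⟨N, hN⟩ : ∃ N, regMeasure G u μ ((⋃ i, f i) \ accumulate f N) < ε / 3 := by
      have ht := tendsto_measure_iInter_atTop (μ := regMeasure G u μ)
        (s := fun N => (⋃ i, f i) \ accumulate f N)
        (fun N => ((MeasurableSet.iUnion hmf).diff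
          (MeasurableSet.biUnion (to_countable _) fun i _ => hmf i)).nullMeasurableSet)
        (fun a b hab => sdiff_subset_sdiff_right (monotone_accumulate hab))
        ⟨0, measure_ne_top _ _⟩
      rw [← sdiff_iUnion, iUnion_accumulate, Set.sdiff_self, measure_empty] at ht
      exact (ht.eventually_lt_const hε3).exists
    obtain ⟨η, hη, hηsum⟩ := ENNReal.exists_pos_sum_of_countable' hε3.ne' ℕ
    choose V hV h using fun i => ih i (η i) (hη i)
    refine ⟨⋂ i ∈ Finset.range (N + 1), V i, (Finset.iInter_mem_sets _).2 fun i _ => hV i,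
      fun g hg => ?_⟩
    set R := (⋃ i, f i) \ accumulate f N
    have hsub : symmDiff (⋃ i, f i) (g • ⋃ i, f i) ⊆
        (R ∪ ⋃ i ∈ Finset.range (N + 1), symmDiff (f i) (g • f i)) ∪ g • R := by
      rw [smul_set_iUnion]
      rintro p (⟨hp1, hp2⟩ | ⟨hp1, hp2⟩)
      · by_cases hpR : p ∈ accumulate f N
        · obtain ⟨i, hi, hpi⟩ := mem_accumulate.1 hpR
          refine Or.inl (Or.inr (mem_iUnion₂.2 ⟨i, Finset.mem_range.2 (by omega),
            Or.inl ⟨hpi, fun h => hp2 (mem_iUnion.2 ⟨i, h⟩)⟩⟩))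
        · exact Or.inl (Or.inl ⟨hp1, hpR⟩)
      · by_cases hpR : g⁻¹ • p ∈ accumulate f N
        · obtain ⟨i, hi, hpi⟩ := mem_accumulate.1 hpR
          refine Or.inl (Or.inr (mem_iUnion₂.2 ⟨i, Finset.mem_range.2 (by omega),
            Or.inr ⟨mem_smul_set_iff_inv_smul_mem.2 hpi, fun h => hp2 (mem_iUnion.2 ⟨i, h⟩)⟩⟩))
        · refine Or.inr (mem_smul_set_iff_inv_smul_mem.2 ⟨?_, hpR⟩)
          obtain ⟨i, hi⟩ := mem_iUnion.1 hp1
          exact mem_iUnion.2 ⟨i, mem_smul_set_iff_inv_smul_mem.1 hi⟩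
    calc _ ≤ _ := measure_mono hsub
      _ ≤ (regMeasure G u μ R + regMeasure G u μ
            (⋃ i ∈ Finset.range (N + 1), symmDiff (f i) (g • f i))) + regMeasure G u μ (g • R) :=
          (measure_union_le _ _).trans (add_le_add_left (measure_union_le _ _) _)
      _ ≤ (ε / 3 + ε / 3) + ε / 3 := by
          rw [measure_smul]
          refine add_le_add (add_le_add hN.le ?_) hN.le
          refine (measure_biUnion_finset_le _ _).trans (le_trans ?_ hηsum.le)
          refine le_trans (Finset.sum_le_sum fun i hi => h i g ?_) (ENNReal.sum_le_tsum _)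
          exact mem_iInter₂.1 hg i hi
      _ = ε := ENNReal.add_thirds ε

theorem isContinuousAction_regMeasure [LocallyCompactSpace G] [T2Space G]
    (hu : (u : Filter ℕ) ≤ cofinite) [∀ n, IsProbabilityMeasure (μ n)] :
    IsContinuousAction G (regMeasure G u μ) := by
  have := measurableConstSMul_regUltraproduct (G := G) (u := u) (μ := μ)
  have := smulInvariantMeasure_regMeasure (G := G) (μ := μ) hu
  refine ⟨fun g A hA => hA.preimage (measurePreserving_smul g _).quasiMeasurePreserving,
    fun g A _ => measure_preimage_smul _ g A, fun A hA ε hε => ?_⟩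
  obtain ⟨S, hS, hAS⟩ := hA
  obtain ⟨V, hV, h⟩ := exists_nhds_regMeasure_symmDiff_le hu hS ε hε
  obtain ⟨K, hK, hKV, hKc⟩ := local_compact_nhds hV
  refine ⟨K, ⟨hKc.measurableSet, hK, K, hKc, subset_rfl⟩, fun g hg => ?_⟩
  have hgAS : (g • A : Set (RegUltraproduct G u μ)) =ᵐ[regMeasure G u μ] (g • S : Set _) :=
    (smul_set_ae_eq g).2 hAS
  rw [measure_congr (hAS.symmDiff hgAS)]
  exact h g (hKV hg)

end Regular

/-! ### The transverse measure of a cross section -/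

/-- A locally compact second countable Hausdorff group is complete for its right uniformity. -/
theorem polishSpace_of_locallyCompact_group (G : Type*) [Group G] [TopologicalSpace G]
    [IsTopologicalGroup G] [LocallyCompactSpace G] [SecondCountableTopology G] [T2Space G] :
    PolishSpace G := by
  let : UniformSpace G := IsTopologicalGroup.rightUniformSpace G
  have : IsRightUniformGroup G := ⟨rfl⟩
  have : CompleteSpace G := IsRightUniformGroup.completeSpace_of_weaklyLocallyCompactSpace
  have : (uniformity G).IsCountablyGenerated :=
    inferInstanceAs (comap (fun p : G × G => p.2 * p.1⁻¹) (𝓝 1)).IsCountablyGenerated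
  infer_instance

theorem exists_seq_iUnion_smul_eq_univ {G : Type*} [Group G] [TopologicalSpace G]
    [IsTopologicalGroup G] [SecondCountableTopology G] {U : Set G} (hU : U ∈ 𝓝 (1 : G)) :
    ∃ d : ℕ → G, ⋃ i, d i • U = univ := by
  refine ⟨TopologicalSpace.denseSeq G, eq_univ_of_forall fun g => ?_⟩
  have hnhds : (fun h : G => h⁻¹ * g) ⁻¹' U ∈ 𝓝 g :=
    (by fun_prop : Continuous fun h : G => h⁻¹ * g).continuousAt.preimage_mem_nhds (by simpa)
  obtain ⟨_, ⟨i, rfl⟩, hx⟩ := (TopologicalSpace.denseRange_denseSeq G).inter_nhds_nonempty hnhds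
  exact mem_iUnion.2 ⟨i, mem_smul_set_iff_inv_smul_mem.2 hx⟩

/-- The pull-back of a measure along a map that is injective on a Borel set `T`, as a measure
concentrated on `T`. -/
theorem exists_measure_eq_image_inter {α β : Type*} [MeasurableSpace α] [StandardBorelSpace α]
    [MeasurableSpace β] [StandardBorelSpace β] (μ : Measure β) {f : α → β} (hf : Measurable f)
    {T : Set α} (hT : MeasurableSet T) (hinj : InjOn f T) :
    ∃ m : Measure α, ∀ E, MeasurableSet E → m E = μ (f '' (E ∩ T)) := by
  have := hT.standardBorel
  have he : MeasurableEmbedding (T.domRestrict f) :=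
    (hf.comp measurable_subtype_coe).measurableEmbedding (injOn_iff_injective.1 hinj)
  refine ⟨(μ.comap (T.domRestrict f)).map Subtype.val, fun E hE => ?_⟩
  rw [Measure.map_apply measurable_subtype_coe hE, he.comap_apply]
  congr 1
  ext x
  constructor
  · rintro ⟨⟨p, hp⟩, hpE, rfl⟩
    exact ⟨p, ⟨hpE, hp⟩, rfl⟩
  · rintro ⟨p, ⟨hpE, hp⟩, rfl⟩
    exact ⟨⟨p, hp⟩, hpE, rfl⟩

/-- The total mass of the images of the pieces of a set does not depend on the countable
partition, as long as the map is injective on each piece. -/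
theorem tsum_measure_image_inter_eq {α β : Type*} [MeasurableSpace α] [StandardBorelSpace α]
    [MeasurableSpace β] [StandardBorelSpace β] (μ : Measure β) {f : α → β} (hf : Measurable f)
    {S T : ℕ → Set α} (hS : ∀ i, MeasurableSet (S i)) (hT : ∀ i, MeasurableSet (T i))
    (hSinj : ∀ i, InjOn f (S i)) (hTinj : ∀ i, InjOn f (T i))
    (hSd : Pairwise (Function.onFun Disjoint S)) (hTd : Pairwise (Function.onFun Disjoint T))
    (hSU : ⋃ i, S i = univ) (hTU : ⋃ i, T i = univ) {E : Set α} (hE : MeasurableSet E) :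
    ∑' i, μ (f '' (E ∩ S i)) = ∑' i, μ (f '' (E ∩ T i)) := by
  have key : ∀ {S T : ℕ → Set α}, (∀ i, MeasurableSet (S i)) → (∀ i, MeasurableSet (T i)) →
      (∀ i, InjOn f (S i)) → Pairwise (Function.onFun Disjoint T) → ⋃ i, T i = univ → ∀ i,
      μ (f '' (E ∩ S i)) = ∑' j, μ (f '' (E ∩ (S i ∩ T j))) := by
    intro S T hS hT hSinj hTd hTU i
    obtain ⟨m, hm⟩ := exists_measure_eq_image_inter μ hf (hS i) (hSinj i)
    have hEU : E = ⋃ j, E ∩ T j := by rw [← inter_iUnion, hTU, inter_univ]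
    rw [← hm E hE]
    conv_lhs => rw [hEU]
    rw [measure_iUnion (fun a b hab => (hTd hab).mono inter_subset_right inter_subset_right)
      (fun j => hE.inter (hT j))]
    refine tsum_congr fun j => ?_
    rw [hm _ (hE.inter (hT j)), inter_assoc, inter_comm (T j)]
  rw [tsum_congr (key hS hT hSinj hTd hTU), tsum_congr (key hT hS hTinj hSd hSU),
    ENNReal.tsum_comm]
  exact tsum_congr fun j => tsum_congr fun i => by rw [inter_comm (S i)]

section Existence

variable {G X : Type*} [Group G] [MulAction G X] [MeasurableSpace X]

theorem IsCrossSection.injOn_coe {U : Set G} {μ : Measure X} {Y : Set X}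
    (hY : IsCrossSection U μ Y) :
    InjOn (fun p : G × Y => p.1 • (p.2 : X)) (U ×ˢ univ) := by
  rintro ⟨g, y⟩ ⟨hg, -⟩ ⟨h, z⟩ ⟨hh, -⟩ heq
  have := hY.2.1 (x₁ := (g, (y : X))) (x₂ := (h, (z : X))) ⟨hg, y.2⟩ ⟨hh, z.2⟩ heq
  rw [Prod.mk.injEq] at this
  exact Prod.ext this.1 (Subtype.ext this.2)

variable [MeasurableSpace G] [MeasurableSMul₂ G X]

theorem measurable_smul_coe (Y : Set X) :
    Measurable fun p : G × Y => p.1 • (p.2 : X) :=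
  measurable_fst.smul (measurable_subtype_coe.comp measurable_snd)

variable [TopologicalSpace G] [IsTopologicalGroup G] [BorelSpace G]
  [LocallyCompactSpace G] [SecondCountableTopology G] [T2Space G] [StandardBorelSpace X]
  {μ : Measure X}

theorem IsCrossSection.measurableSet_image {U : Set G} {Y : Set X}
    (hY : IsCrossSection U μ Y) {E : Set (G × Y)} (hE : MeasurableSet E) (hEU : E ⊆ U ×ˢ univ) :
    MeasurableSet ((fun p : G × Y => p.1 • (p.2 : X)) '' E) := by
  have := polishSpace_of_locallyCompact_group G
  have := hY.1.standardBorel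
  exact hE.image_of_measurable_injOn (measurable_smul_coe Y) (hY.injOn_coe.mono hEU)

theorem image_smul_coe_prod_univ {G X : Type*} [SMul G X] (U : Set G) (Y : Set X) :
    (fun p : G × Y => p.1 • (p.2 : X)) '' (U ×ˢ univ) = U • Y := by
  ext x
  constructor
  · rintro ⟨⟨g, y⟩, ⟨hg, -⟩, rfl⟩
    exact smul_mem_smul hg y.2
  · rintro ⟨g, hg, y, hy, rfl⟩
    exact ⟨(g, ⟨y, hy⟩), ⟨hg, mem_univ _⟩, rfl⟩

theorem IsCrossData.ofReal_mul_measure_image {lam : Measure G} [lam.IsHaarMeasure] {U : Set G}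
    {Y : Set X} (hY : IsCrossSection U μ Y) {ν : Measure Y} {c : ℝ}
    (h : IsCrossData lam U μ Y ν c)
    {E : Set (G × Y)} (hE : MeasurableSet E) (hEU : E ⊆ U ×ˢ univ) :
    ENNReal.ofReal c * μ ((fun p : G × Y => p.1 • (p.2 : X)) '' E) = lam.prod ν E := by
  have := h.1
  have hm := hY.measurableSet_image hE hEU
  have key := congrArg (fun m => m ((fun p : G × Y => p.1 • (p.2 : X)) '' E)) h.2.2
  simp only [Measure.map_apply (measurable_smul_coe Y) hm, Measure.smul_apply,
    Measure.restrict_apply hm, smul_eq_mul] at key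
  rw [inter_eq_left.2 (by rw [← image_smul_coe_prod_univ]; exact image_mono hEU)] at key
  conv_lhs at key => rw [← Measure.restrict_univ (μ := ν)]
  rw [← key, Measure.prod_restrict, Measure.restrict_apply (measurable_smul_coe Y hm)]
  congr 1
  ext p
  constructor
  · rintro ⟨⟨q, hq, hqp⟩, hp⟩
    exact hY.injOn_coe (hEU hq) hp hqp ▸ hq
  · exact fun hp => ⟨⟨p, hp, rfl⟩, hEU hp⟩

variable [IsProbabilityMeasure μ] [SMulInvariantMeasure G X μ]

/-- For a Borel subset `A` of a cross section, `B ↦ μ(B A)` is a multiple of Haar measure on the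
Borel subsets of `U`. Partitioning `G` into pieces of translates of `U` extends it to a
left-invariant, locally finite measure on `G`. -/
theorem exists_measure_image_prod_eq_mul (lam : Measure G) [lam.IsHaarMeasure] {U : Set G}
    (hU : IsOpen U) (hU1 : (1 : G) ∈ U) {Y : Set X} (hY : IsCrossSection U μ Y)
    {A : Set Y} (hA : MeasurableSet A) :
    ∃ κ : ℝ≥0∞, ∀ B ⊆ U, MeasurableSet B →
      μ ((fun p : G × Y => p.1 • (p.2 : X)) '' (B ×ˢ A)) = κ * lam B := by
  have := polishSpace_of_locallyCompact_group G
  have := hY.1.standardBorel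
  set Φ : G × Y → X := fun p => p.1 • (p.2 : X)
  have hΦ : Measurable Φ := measurable_smul_coe Y
  have hinj : ∀ (g : G) (D : Set G), D ⊆ g • U → InjOn Φ (D ×ˢ univ) := by
    rintro g D hD ⟨a, y⟩ ⟨ha, -⟩ ⟨b, z⟩ ⟨hb, -⟩ heq
    have := hY.injOn_coe (x₁ := (g⁻¹ * a, y)) (x₂ := (g⁻¹ * b, z))
      ⟨mem_smul_set_iff_inv_smul_mem.1 (hD ha), mem_univ _⟩
      ⟨mem_smul_set_iff_inv_smul_mem.1 (hD hb), mem_univ _⟩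
      (by simpa only [mul_smul] using congrArg (g⁻¹ • ·) heq)
    simpa using this
  obtain ⟨d, hd⟩ := exists_seq_iUnion_smul_eq_univ (hU.mem_nhds hU1)
  set D := disjointed fun i => d i • U
  have hDm : ∀ i, MeasurableSet (D i) :=
    MeasurableSet.disjointed fun i => (hU.smul (d i)).measurableSet
  have hDsub : ∀ i, D i ⊆ d i • U := disjointed_subset _
  have hDd : Pairwise (Function.onFun Disjoint D) := disjoint_disjointed _
  have hDU : ⋃ i, D i = univ := by rw [iUnion_disjointed, hd]
  have hTm : ∀ i, MeasurableSet (D i ×ˢ (univ : Set Y)) := fun i => (hDm i).prod .univ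
  have hTd : Pairwise (Function.onFun Disjoint fun i => D i ×ˢ (univ : Set Y)) :=
    fun i j hij => Disjoint.set_prod_left (hDd hij) _ _
  have hTU : ⋃ i, D i ×ˢ (univ : Set Y) = univ := by rw [← iUnion_prod_const, hDU, univ_prod_univ]
  choose m hm using fun i => exists_measure_eq_image_inter μ hΦ (hTm i) (hinj _ _ (hDsub i))
  -- the extension of `B ↦ μ (B A)` to all Borel subsets of `G`
  set N : Measure G := ((Measure.sum m).restrict (univ ×ˢ A)).map Prod.fst with hN
  have hNapp : ∀ B, MeasurableSet B → N B = ∑' i, μ (Φ '' ((B ×ˢ A) ∩ D i ×ˢ univ)) := by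
    intro B hB
    rw [hN, Measure.map_apply measurable_fst hB, Measure.restrict_apply (measurable_fst hB),
      show Prod.fst ⁻¹' B ∩ (univ : Set G) ×ˢ A = B ×ˢ A by ext; simp,
      Measure.sum_apply _ (hB.prod hA)]
    exact tsum_congr fun i => hm i _ (hB.prod hA)
  have hNinv : N.IsMulLeftInvariant := by
    refine ⟨fun g => Measure.ext fun B hB => ?_⟩
    rw [Measure.map_apply (measurable_const_mul g) hB, hNapp _ (measurable_const_mul g hB),
      hNapp _ hB]
    have hgm : ∀ i, MeasurableSet ((g • D i) ×ˢ (univ : Set Y)) := fun i =>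
      ((hDm i).const_smul g).prod .univ
    -- left translation by `g` moves one admissible partition to another
    rw [tsum_measure_image_inter_eq μ hΦ hTm hgm (fun i => hinj _ _ (hDsub i))
      (fun i => hinj (g * d i) _ (by rw [mul_smul]; exact smul_set_mono (hDsub i))) hTd
      (fun i j hij => Disjoint.set_prod_left (by
        have := hDd hij
        exact (disjoint_image_iff (MulAction.injective g)).2 this) _ _) hTU
      (by rw [← iUnion_prod_const, ← smul_set_iUnion, hDU, smul_set_univ, univ_prod_univ])
      (hB.prod hA)]
    refine tsum_congr fun i => ?_
    rw [← measure_smul μ g]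
    congr 1
    ext x
    constructor
    · rintro ⟨_, ⟨⟨h, y⟩, ⟨⟨hB', hy⟩, hD', -⟩, rfl⟩, rfl⟩
      exact ⟨(g * h, y), ⟨⟨hB', hy⟩, smul_mem_smul_set hD', mem_univ _⟩, mul_smul _ _ _⟩
    · rintro ⟨⟨h, y⟩, ⟨⟨hB', hy⟩, hD', -⟩, rfl⟩
      refine ⟨_, ⟨(g⁻¹ * h, y), ⟨⟨?_, hy⟩, mem_smul_set_iff_inv_smul_mem.1 hD', mem_univ _⟩, rfl⟩,
        ?_⟩
      · simpa using hB'
      · simp [Φ, mul_smul]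
  have hNU : ∀ B ⊆ U, MeasurableSet B → N B = μ (Φ '' (B ×ˢ A)) := by
    intro B hBU hB
    obtain ⟨m₀, hm₀⟩ := exists_measure_eq_image_inter μ hΦ
      (hU.measurableSet.prod (MeasurableSet.univ (α := Y))) hY.injOn_coe
    have hsub : ∀ E ⊆ B ×ˢ A, E ∩ U ×ˢ univ = E := fun E hE =>
      inter_eq_left.2 fun p hp => ⟨hBU (hE hp).1, mem_univ _⟩
    rw [hNapp B hB]
    calc _ = ∑' i, m₀ ((B ×ˢ A) ∩ D i ×ˢ univ) := tsum_congr fun i => by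
          rw [hm₀ _ ((hB.prod hA).inter (hTm i)), hsub _ inter_subset_left]
      _ = m₀ (B ×ˢ A) := by
          rw [← measure_iUnion (fun a b hab => (hTd hab).mono inter_subset_right
            inter_subset_right) (fun i => (hB.prod hA).inter (hTm i)), ← inter_iUnion, hTU,
            inter_univ]
      _ = _ := by rw [hm₀ _ (hB.prod hA), hsub _ subset_rfl]
  have hNfin : IsLocallyFiniteMeasure N := by
    refine ⟨fun g => ⟨g • U, (hU.smul g).mem_nhds ⟨1, hU1, by simp⟩, ?_⟩⟩
    rw [measure_smul, hNU U subset_rfl hU.measurableSet]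
    exact measure_lt_top _ _
  refine ⟨Measure.haarScalarFactor N lam, fun B hBU hB => ?_⟩
  rw [← hNU B hBU hB]
  conv_lhs => rw [Measure.isMulLeftInvariant_eq_smul N lam]
  rfl

/-- Every cross section carries a transverse probability measure and has finite covolume. -/
theorem exists_isCrossData (lam : Measure G) [lam.IsHaarMeasure] {U : Set G}
    (hU : IsOpen U) (hU1 : (1 : G) ∈ U) {Y : Set X} (hY : IsCrossSection U μ Y) :
    ∃ q : Measure Y × ℝ, IsCrossData lam U μ Y q.1 q.2 := by
  have := polishSpace_of_locallyCompact_group G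
  have := hY.1.standardBorel
  have hΦ := measurable_smul_coe (G := G) Y
  obtain ⟨m, hm⟩ := exists_measure_eq_image_inter μ hΦ
      (hU.measurableSet.prod (MeasurableSet.univ (α := Y))) hY.injOn_coe
  have hm' : ∀ B (A : Set Y), MeasurableSet B → MeasurableSet A → m (B ×ˢ A) =
      μ ((fun p : G × Y => p.1 • (p.2 : X)) '' ((B ∩ U) ×ˢ A)) := fun B A hB hA => by
    rw [hm _ (hB.prod hA), prod_inter_prod, inter_univ]
  have hmU : m univ = μ (U • Y) := by
    rw [hm _ .univ, univ_inter, image_smul_coe_prod_univ]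
  have hmfin : IsFiniteMeasure m := ⟨by rw [hmU]; exact measure_lt_top _ _⟩
  -- countably many translates of `U • Y` cover the conull set `G • Y`
  have hpos : μ (U • Y) ≠ 0 := by
    intro h0
    obtain ⟨d, hd⟩ := exists_seq_iUnion_smul_eq_univ (hU.mem_nhds hU1)
    have huniv : μ ((univ : Set G) • Y) = 0 := by
      rw [← hd, iUnion_smul, measure_iUnion_null_iff]
      intro i
      rw [smul_assoc, measure_smul, h0]
    have : μ univ ≤ 0 := by
      rw [← union_compl_self ((univ : Set G) • Y)]
      exact (measure_union_le _ _).trans (by rw [huniv, hY.2.2, add_zero])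
    simp at this
  set ν := m.map Prod.snd with hν
  have hνapp : ∀ A, MeasurableSet A → ν A = m (univ ×ˢ A) := fun A hA => by
    rw [hν, Measure.map_apply measurable_snd hA, univ_prod]
  obtain ⟨κ, hκ⟩ := exists_measure_image_prod_eq_mul lam hU hU1 hY (A := univ) .univ
  have hκU := hκ U subset_rfl hU.measurableSet
  rw [image_smul_coe_prod_univ] at hκU
  have hlam0 : lam U ≠ 0 := (hU.measure_pos lam ⟨1, hU1⟩).ne'
  -- `κ * lam U = μ (U • Y)` is positive and finite, so `lam U` is finite
  have hlamtop : lam U ≠ ∞ := by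
    intro htop
    rw [htop] at hκU
    by_cases hκ0 : κ = 0
    · rw [hκ0, zero_mul] at hκU; exact hpos hκU
    · rw [ENNReal.mul_top hκ0] at hκU; exact measure_ne_top _ _ hκU
  have hprod : (lam.restrict U).prod ν = lam U • m := by
    have : IsFiniteMeasure (lam.restrict U) := ⟨by simpa using hlamtop.lt_top⟩
    have : IsFiniteMeasure ν := inferInstance
    refine Measure.prod_eq fun B A hB hA => ?_
    obtain ⟨κ, hκ⟩ := exists_measure_image_prod_eq_mul lam hU hU1 hY hA
    rw [Measure.smul_apply, hm' B A hB hA, hκ _ inter_subset_right (hB.inter hU.measurableSet),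
      Measure.restrict_apply hB, hνapp A hA, hm' _ _ .univ hA, univ_inter,
      hκ U subset_rfl hU.measurableSet, smul_eq_mul]
    ring
  have hmap : m.map (fun p : G × Y => p.1 • (p.2 : X)) = μ.restrict (U • Y) := by
    refine Measure.ext fun E hE => ?_
    rw [Measure.map_apply hΦ hE, Measure.restrict_apply hE, hm _ (hΦ hE),
      image_preimage_inter, image_smul_coe_prod_univ]
  refine ⟨((μ (U • Y))⁻¹ • ν, (lam U / μ (U • Y)).toReal), ⟨?_⟩, ?_, ?_⟩
  · rw [Measure.smul_apply, hνapp _ .univ, univ_prod_univ, hmU, smul_eq_mul,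
      ENNReal.inv_mul_cancel hpos (measure_ne_top _ _)]
  · exact ENNReal.toReal_pos (ENNReal.div_pos hlam0 (measure_ne_top _ _)).ne'
      (ENNReal.div_ne_top hlamtop hpos)
  · rw [ENNReal.ofReal_toReal (ENNReal.div_ne_top hlamtop hpos), Measure.prod_smul_right, hprod,
      Measure.map_smul, Measure.map_smul, hmap, smul_smul, div_eq_mul_inv, mul_comm]

theorem isCrossData_crossMeasure (lam : Measure G) [lam.IsHaarMeasure] {U : Set G}
    (hU : IsOpen U) (hU1 : (1 : G) ∈ U) {Y : Set X} (hY : IsCrossSection U μ Y) :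
    IsCrossData lam U μ Y (crossMeasure lam U μ Y) (covol lam U μ Y) :=
  Classical.epsilon_spec (exists_isCrossData lam hU hU1 hY)

end Existence

/-! ### The measure of preimages under `Ψ` -/

/-- A property of all sequences with ultralimit `g` holds uniformly on a neighborhood of `g`. -/
theorem exists_nhds_eventually_of_forall_tendsto {u : Ultrafilter ℕ}
    (hu : (u : Filter ℕ) ≤ cofinite) {G : Type*} [TopologicalSpace G] [FirstCountableTopology G]
    {g : G} {P : ℕ → G → Prop}
    (h : ∀ k : ℕ → G, Tendsto k u (𝓝 g) → ∀ᶠ n in u, P n (k n)) :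
    ∃ W ∈ 𝓝 g, ∀ᶠ n in u, ∀ k ∈ W, P n k := by
  classical
  by_contra! hcon
  obtain ⟨V, hV⟩ := (𝓝 g).exists_antitone_basis
  -- otherwise a diagonal sequence of violations converges to `g`
  have hp : ∀ j, ∀ᶠ n in u, ∃ k ∈ V j, ¬ P n k := fun j =>
    hcon (V j) (hV.1.mem_of_mem trivial)
  obtain ⟨f, hf, hfn⟩ := exists_tendsto_atTop_diagonal hu hp
  obtain ⟨k, hk⟩ : ∃ k : ℕ → G, ∀ᶠ n in u, k n ∈ V (f n) ∧ ¬ P n (k n) := by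
    refine ⟨fun n => if h : ∃ k ∈ V (f n), ¬ P n k then h.choose else g, ?_⟩
    filter_upwards [hfn] with n hn
    rw [dif_pos hn]
    exact hn.choose_spec
  have hlim : Tendsto k u (𝓝 g) := by
    refine hV.1.tendsto_right_iff.2 fun m _ => ?_
    filter_upwards [hk, hf.eventually_ge_atTop m] with n hn hm
    exact hV.2 hm hn.1
  obtain ⟨n, hn, hn'⟩ := ((h k hlim).and hk).exists
  exact hn'.2 hn

theorem internalSet_biUnion {u : Ultrafilter ℕ} {X : ℕ → Type*} {ι : Type*} (t : Finset ι)
    (C : ι → ∀ n, Set (X n)) :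
    internalSet u (fun n => ⋃ i ∈ t, C i n) = ⋃ i ∈ t, internalSet u (C i) := by
  ext p
  obtain ⟨x, rfl⟩ := Ultraproduct.exists_mk p
  simp only [mk_mem_internalSet, mem_iUnion, exists_prop]
  exact Ultrafilter.eventually_exists_mem_iff (is := (t : Set ι)) t.finite_toSet

/-- The measure of a finite union of rectangles `P i ×ˢ C i`, computed on the atoms of the finite
algebra generated by the `P i`. -/
theorem measure_prod_biUnion_rectangles {α β ι : Type*} [MeasurableSpace α] [MeasurableSpace β]
    (m : Measure α) (ν : Measure β) [SFinite m] [SFinite ν] (s : Finset ι) {P : ι → Set α}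
    {C : ι → Set β} (hP : ∀ i, MeasurableSet (P i)) (hC : ∀ i, MeasurableSet (C i)) :
    m.prod ν (⋃ i ∈ s, P i ×ˢ C i) =
      ∑ t ∈ s.powerset, m {g | ∀ i ∈ s, g ∈ P i ↔ i ∈ t} * ν (⋃ i ∈ t, C i) := by
  classical
  have hQ : ∀ t : Finset ι, MeasurableSet {g | ∀ i ∈ s, g ∈ P i ↔ i ∈ t} := by
    intro t
    have : {g | ∀ i ∈ s, g ∈ P i ↔ i ∈ t} = ⋂ i ∈ s, {g | g ∈ P i ↔ i ∈ t} := by ext; simp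
    rw [this]
    exact Finset.measurableSet_biInter _ fun i _ => MeasurableSet.iff (hP i) (.const _)
  have heq : (⋃ i ∈ s, P i ×ˢ C i) =
      ⋃ t ∈ s.powerset, {g | ∀ i ∈ s, g ∈ P i ↔ i ∈ t} ×ˢ ⋃ i ∈ t, C i := by
    ext ⟨g, y⟩
    simp only [mem_iUnion, mem_prod, mem_ofPred_eq, exists_prop, Finset.mem_powerset]
    constructor
    · rintro ⟨i, hi, hg, hy⟩
      refine ⟨s.filter fun i => g ∈ P i, Finset.filter_subset _ _, ?_, i, ?_, hy⟩
      · intro j hj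
        simp [hj]
      · simp [hi, hg]
    · rintro ⟨t, ht, hg, i, hi, hy⟩
      exact ⟨i, ht hi, (hg i (ht hi)).2 hi, hy⟩
  rw [heq, measure_biUnion_finset]
  · exact Finset.sum_congr rfl fun t _ => Measure.prod_prod _ _
  · intro t ht t' ht' hne
    refine Disjoint.set_prod_left (disjoint_left.2 fun g hg hg' => hne ?_) _ _
    ext i
    rw [Finset.mem_coe, Finset.mem_powerset] at ht ht'
    exact ⟨fun hi => (hg' i (ht hi)).1 ((hg i (ht hi)).2 hi),
      fun hi => (hg i (ht' hi)).1 ((hg' i (ht' hi)).2 hi)⟩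
  · exact fun t _ => (hQ t).prod (Finset.measurableSet_biUnion _ fun i _ => hC i)

/-- On finite unions of rectangles with internal second sides, the product with a Loeb measure is
the ultralimit of the products. There is no dominated convergence along an ultrafilter, but here the
measure of a slice takes only finitely many values. -/
theorem tendsto_measure_prod_biUnion_rectangles {u : Ultrafilter ℕ}
    (hu : (u : Filter ℕ) ≤ cofinite) {α ι : Type*} [MeasurableSpace α] {Y : ℕ → Type*}
    [∀ n, MeasurableSpace (Y n)] (m : Measure α) [IsFiniteMeasure m] (ν : ∀ n, Measure (Y n))
    [∀ n, IsProbabilityMeasure (ν n)] (s : Finset ι) {P : ι → Set α}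
    {C : ι → ∀ n, Set (Y n)} (hP : ∀ i, MeasurableSet (P i))
    (hC : ∀ i n, MeasurableSet (C i n)) :
    Tendsto (fun n => m.prod (ν n) (⋃ i ∈ s, P i ×ˢ C i n)) u
      (𝓝 (m.prod (loebMeasure u ν) (⋃ i ∈ s, P i ×ˢ internalSet u (C i)))) := by
  have := isProbabilityMeasure_loebMeasure (μ := ν) hu
  rw [measure_prod_biUnion_rectangles _ _ _ hP fun i => measurableSet_internalSet u (hC i)]
  simp only [measure_prod_biUnion_rectangles _ _ _ hP fun i => hC i _]
  refine tendsto_finsetSum _ fun t _ => ENNReal.Tendsto.const_mul ?_ (.inr (measure_ne_top _ _))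
  rw [← internalSet_biUnion]
  exact tendsto_loebMeasure_internalSet hu fun n =>
    Finset.measurableSet_biUnion _ fun i _ => hC i n

section Cover

variable {G : Type*} [Group G] [TopologicalSpace G] [IsTopologicalGroup G]
  {u : Ultrafilter ℕ} {X : ℕ → Type*} [∀ n, MeasurableSpace (X n)]
  [∀ n, MulAction G (X n)] {μ : ∀ n, Measure (X n)} {Y : ∀ n, Set (X n)}

theorem crossMap_mk (g : G) (y : ∀ n, Y n) :
    crossMap G u μ Y (g, Ultraproduct.mk u y) =
      RegUltraproduct.mk G u μ fun n => g • (y n : X n) := rfl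

theorem mk_smul_eq_crossMap {g : G} {k : ℕ → G} (hk : Tendsto k u (𝓝 g)) (y : ∀ n, Y n) :
    RegUltraproduct.mk G u μ (fun n => k n • (y n : X n)) =
      crossMap G u μ Y (g, Ultraproduct.mk u y) := by
  rw [crossMap_mk, RegUltraproduct.mk_eq_mk]
  refine ⟨fun n => g * (k n)⁻¹, ?_, .of_forall fun n => by simp [smul_smul]⟩
  simpa using (tendsto_const_nhds (x := g)).mul hk.inv

variable [LocallyCompactSpace G] [SecondCountableTopology G] [T2Space G]
  [MeasurableSpace G] [BorelSpace G] {lam : Measure G} [lam.IsHaarMeasure]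
  [∀ n, StandardBorelSpace (X n)] [∀ n, MeasurableSMul₂ G (X n)]
  [∀ n, IsProbabilityMeasure (μ n)]
  {U' : Set G} {ν : ∀ n, Measure (Y n)} {c : ℕ → ℝ} {c₀ : ℝ}

/-- In particular `λ(U')` is finite and at most the covolume. -/
theorem IsCrossSection.lam_eq {X : Type*} [MeasurableSpace X] [StandardBorelSpace X]
    [MulAction G X] [MeasurableSMul₂ G X] {μ : Measure X} {Y : Set X} {ν : Measure Y} {c : ℝ}
    {U' : Set G} (hU' : IsOpen U')
    (hY : IsCrossSection U' μ Y) (h : IsCrossData lam U' μ Y ν c) :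
    lam U' = ENNReal.ofReal c * μ (U' • Y) := by
  have := h.1
  rw [← image_smul_coe_prod_univ, h.ofReal_mul_measure_image hY (hU'.measurableSet.prod .univ)
    subset_rfl, Measure.prod_prod, measure_univ, mul_one]

/-- The central estimate. The preimage of `S` in the ultraproduct is covered by an internal set
`[B_n]`. If `Ψ(g, [y_n]) ∈ S` then, by saturation, `O y_n ⊆ B_n` almost everywhere for some basic
open set `O` containing `g`. Hence `Ψ⁻¹(S)` is covered by countably many rectangles, and each
finite union of them is the ultraproduct of subsets of `{(h, y) | h y ∈ B_n}`, up to null sets. -/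
theorem measure_preimage_crossMap_le (hu : (u : Filter ℕ) ≤ cofinite) (hU' : IsOpen U')
    (hY : ∀ n, IsCrossSection U' (μ n) (Y n))
    (hdata : ∀ n, IsCrossData lam U' (μ n) (Y n) (ν n) (c n))
    (hc : Tendsto c u (𝓝 c₀)) (hc₀ : 0 < c₀) (S : Set (RegUltraproduct G u μ)) :
    (lam.restrict U').prod (loebMeasure u ν) (crossMap G u μ Y ⁻¹' S) ≤
      ENNReal.ofReal c₀ * regMeasure G u μ S := by
  have : ∀ n, IsProbabilityMeasure (ν n) := fun n => (hdata n).1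
  have hfin : IsFiniteMeasure (lam.restrict U') := by
    refine ⟨?_⟩
    rw [Measure.restrict_apply_univ, (hY 0).lam_eq hU' (hdata 0)]
    exact ENNReal.mul_lt_top ENNReal.ofReal_lt_top (measure_lt_top _ _)
  have hofc : ENNReal.ofReal c₀ ≠ 0 := (ENNReal.ofReal_pos.2 hc₀).ne'
  suffices key : ∀ δ, regMeasure G u μ S < δ →
      (lam.restrict U').prod (loebMeasure u ν) (crossMap G u μ Y ⁻¹' S) ≤
        ENNReal.ofReal c₀ * δ by
    refine le_of_forall_gt_imp_ge_of_dense fun δ hδ => ?_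
    refine (key (δ / ENNReal.ofReal c₀) ?_).trans (ENNReal.mul_div_le)
    rwa [ENNReal.lt_div_iff_mul_lt (.inl hofc) (.inl ENNReal.ofReal_ne_top), mul_comm]
  intro δ hδ
  obtain ⟨B, hB, hSB, hlt⟩ := exists_superset_of_regMeasure_lt hu hδ
  obtain ⟨O, hO⟩ := (TopologicalSpace.countable_countableBasis G).exists_eq_range
    (Nonempty.of_sUnion_eq_univ (TopologicalSpace.isBasis_countableBasis G).sUnion_eq)
  have hOo : ∀ i, IsOpen (O i) := fun i =>
    TopologicalSpace.isOpen_of_mem_countableBasis (hO ▸ mem_range_self i)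
  let C : ℕ → ∀ n, Set (Y n) := fun i n =>
    {y | lam ((fun h : G => (h, y)) ⁻¹' {p : G × Y n | p.1 ∈ O i ∧ p.1 • (p.2 : X n) ∉ B n}) = 0}
  have hEm : ∀ i n, MeasurableSet {p : G × Y n | p.1 ∈ O i ∧ p.1 • (p.2 : X n) ∉ B n} :=
    fun i n => ((hOo i).measurableSet.preimage measurable_fst).inter
      (((hB n).compl).preimage (measurable_smul_coe (Y n)))
  have hC : ∀ i n, MeasurableSet (C i n) := fun i n =>
    measurable_measure_prodMk_right (μ := lam) (hEm i n) (measurableSet_singleton 0)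
  let R : ℕ → Set (G × Ultraproduct u fun n => Y n) := fun N =>
    ⋃ i ∈ Finset.range N, O i ×ˢ internalSet u (C i)
  have hRmono : Monotone R := fun N N' h => biUnion_subset_biUnion_left fun i hi => by
    have := Finset.mem_range.1 hi
    exact Finset.mem_range.2 (by omega)
  have hcover : crossMap G u μ Y ⁻¹' S ⊆ ⋃ N, R N := by
    rintro ⟨g, p⟩ hp
    obtain ⟨y, rfl⟩ := Ultraproduct.exists_mk p
    obtain ⟨W, hW, hWB⟩ := exists_nhds_eventually_of_forall_tendsto hu
      (P := fun n k => k • (y n : X n) ∈ B n) (g := g) fun k hk => by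
        refine hSB (fun n => k n • (y n : X n)) ?_
        rw [mk_smul_eq_crossMap hk]
        exact hp
    obtain ⟨_, hb, hgb, hbW⟩ := (TopologicalSpace.isBasis_countableBasis G).mem_nhds_iff.1 hW
    rw [hO] at hb
    obtain ⟨i, rfl⟩ := hb
    refine mem_iUnion.2 ⟨i + 1, mem_iUnion₂.2 ⟨i, Finset.self_mem_range_succ i, hgb,
      mk_mem_internalSet.2 ?_⟩⟩
    filter_upwards [hWB] with n hn
    refine (congrArg lam (eq_empty_of_forall_notMem fun h hh => ?_)).trans measure_empty
    exact hh.2 (hn h (hbW hh.1))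
  refine (measure_mono hcover).trans ?_
  rw [hRmono.measure_iUnion]
  refine iSup_le fun N => ?_
  refine le_of_tendsto_of_tendsto
    (tendsto_measure_prod_biUnion_rectangles hu (lam.restrict U') ν (Finset.range N)
      (fun i => (hOo i).measurableSet) hC)
    (ENNReal.Tendsto.mul_const (ENNReal.tendsto_ofReal hc) (.inl hofc)) ?_
  filter_upwards [hlt] with n hn
  have hnull : ∀ i, (lam.restrict U').prod (ν n)
      ((O i ×ˢ C i n) \ (fun p : G × Y n => p.1 • (p.2 : X n)) ⁻¹' B n) = 0 := by
    intro i
    rw [Measure.prod_apply_symm (((hOo i).measurableSet.prod (hC i n)).diff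
      (measurable_smul_coe (Y n) (hB n)))]
    refine (lintegral_congr fun y => ?_).trans lintegral_zero
    refine le_antisymm ((Measure.restrict_apply_le _ _).trans ?_) zero_le
    by_cases hy : y ∈ C i n
    · exact le_trans (measure_mono fun h hh => (⟨hh.1.1, hh.2⟩ : _ ∧ _)) (le_of_eq hy)
    · refine (measure_mono (t := ∅) fun h hh => hy hh.1.2).trans_eq measure_empty
  calc (lam.restrict U').prod (ν n) (⋃ i ∈ Finset.range N, O i ×ˢ C i n)
      ≤ (lam.restrict U').prod (ν n) ((fun p : G × Y n => p.1 • (p.2 : X n)) ⁻¹' B n) := by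
        refine measure_mono_ae (ae_le_set.2 ?_)
        simp only [iUnion_sdiff]
        exact measure_biUnion_null_iff (Finset.countable_toSet _) |>.2 fun i _ => hnull i
    _ = ENNReal.ofReal (c n) * (μ n).restrict (U' • Y n) (B n) := by
        rw [← Measure.map_apply (measurable_smul_coe (Y n)) (hB n), (hdata n).2.2,
          Measure.smul_apply, smul_eq_mul]
    _ ≤ ENNReal.ofReal (c n) * δ :=
        mul_le_mul_right ((Measure.restrict_apply_le _ _).trans hn.le) _

end Cover

/-! ### The ultraproduct cross section -/

section External

variable {G : Type*} [Group G] [TopologicalSpace G] [IsTopologicalGroup G]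
  {u : Ultrafilter ℕ} {X : ℕ → Type*} [∀ n, MeasurableSpace (X n)]
  [∀ n, MulAction G (X n)] {μ : ∀ n, Measure (X n)} {Y : ∀ n, Set (X n)} {U' U : Set G}

theorem crossMap_mul (g h : G) (p : Ultraproduct u fun n => Y n) :
    crossMap G u μ Y (g * h, p) = g • crossMap G u μ Y (h, p) := by
  obtain ⟨y, rfl⟩ := Ultraproduct.exists_mk p
  exact congrArg (RegUltraproduct.mk G u μ) (funext fun n => mul_smul g h _)

/-- If `k_n g y_n = h z_n` with `k_n → 1`, then `k_n g` lies in the open set `U'` almost everywhere,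
where the action map of `Y_n` is injective. -/
theorem injOn_crossMap (hU' : IsOpen U') (hY : ∀ n, IsCrossSection U' (μ n) (Y n)) [T2Space G] :
    InjOn (crossMap G u μ Y) (U' ×ˢ univ) := by
  rintro ⟨g, p⟩ ⟨hg, -⟩ ⟨h, q⟩ ⟨hh, -⟩ heq
  obtain ⟨y, rfl⟩ := Ultraproduct.exists_mk p
  obtain ⟨z, rfl⟩ := Ultraproduct.exists_mk q
  obtain ⟨k, hk, hkyz⟩ := RegUltraproduct.mk_eq_mk.1 heq
  have hkg : Tendsto (fun n => k n * g) u (𝓝 g) := by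
    simpa using hk.mul (tendsto_const_nhds (x := g))
  have hev : ∀ᶠ n in u, k n * g = h ∧ y n = z n := by
    filter_upwards [hkyz, hkg.eventually (hU'.mem_nhds hg)] with n hn hn'
    have := (hY n).injOn_coe (x₁ := (k n * g, y n)) (x₂ := (h, z n)) ⟨hn', mem_univ _⟩
      ⟨hh, mem_univ _⟩ (by simpa only [mul_smul] using hn)
    exact Prod.mk.inj this
  have hgh : g = h := tendsto_nhds_unique hkg
    (tendsto_const_nhds.congr' (hev.mono fun n hn => hn.1.symm))
  rw [hgh, Ultraproduct.mk_eq_mk.2 (hev.mono fun n hn => hn.2)]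

/-- By compactness, the group coordinates in `K` of a sequence can be replaced by their
ultralimit. -/
theorem image_crossMap_prod_internalSet [∀ n, Nonempty (Y n)] {K : Set G} (hK : IsCompact K)
    (A : ∀ n, Set (Y n)) :
    crossMap G u μ Y '' (K ×ˢ internalSet u A) =
      regSet G u μ fun n => (fun p : G × Y n => p.1 • (p.2 : X n)) '' (K ×ˢ A n) := by
  classical
  ext x
  constructor
  · rintro ⟨⟨g, _⟩, ⟨hg, y, rfl, hy⟩, rfl⟩
    exact ⟨Ultraproduct.mk u fun n => g • (y n : X n), mk_mem_internalSet.2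
      (hy.mono fun n hn => ⟨(g, y n), ⟨hg, hn⟩, rfl⟩), rfl⟩
  · rintro ⟨_, ⟨x, rfl, hx⟩, rfl⟩
    obtain ⟨q, hq⟩ : ∃ q : ∀ n, G × Y n, ∀ᶠ n in u, q n ∈ K ×ˢ A n ∧
        (q n).1 • ((q n).2 : X n) = x n := by
      refine ⟨fun n => if h : ∃ q : G × Y n, q ∈ K ×ˢ A n ∧ q.1 • (q.2 : X n) = x n then
        h.choose else (1, Classical.arbitrary _), ?_⟩
      filter_upwards [hx] with n hn
      have hn' : ∃ q : G × Y n, q ∈ K ×ˢ A n ∧ q.1 • (q.2 : X n) = x n := hn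
      rw [dif_pos hn']
      exact hn'.choose_spec
    obtain ⟨g, hg, hlim⟩ := hK.ultrafilter_le_nhds (u.map fun n => (q n).1)
      (le_principal_iff.2 (hq.mono fun n hn => hn.1.1))
    refine ⟨(g, Ultraproduct.mk u fun n => (q n).2), ⟨hg, mk_mem_internalSet.2
      (hq.mono fun n hn => hn.1.2)⟩, ?_⟩
    rw [← mk_smul_eq_crossMap (k := fun n => (q n).1) hlim]
    exact RegUltraproduct.mk_eq_mk.2 ⟨fun _ => 1, tendsto_const_nhds,
      hq.mono fun n hn => by rw [one_smul]; exact hn.2⟩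

theorem image_crossMap_prod_univ [∀ n, Nonempty (Y n)] (hU : IsCompact U) :
    crossMap G u μ Y '' (U ×ˢ univ) = regSet G u μ fun n => U • Y n := by
  rw [← internalSet_univ, image_crossMap_prod_internalSet hU]
  simp only [image_smul_coe_prod_univ]

theorem crossMap_mem_crossSaturation [∀ n, Nonempty (Y n)] (hU : IsCompact U)
    (hU1 : (1 : G) ∈ U) (p : G × Ultraproduct u fun n => Y n) :
    crossMap G u μ Y p ∈ crossSaturation G u μ Y U := by
  refine ⟨p.1, mem_univ _, crossMap G u μ Y (1, p.2), ?_, ?_⟩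
  · rw [← image_crossMap_prod_univ hU]
    exact mem_image_of_mem _ ⟨hU1, mem_univ _⟩
  · exact (crossMap_mul p.1 1 p.2).symm.trans (by rw [mul_one])

theorem range_crossMap [∀ n, Nonempty (Y n)] (hU : IsCompact U) (hU1 : (1 : G) ∈ U) :
    range (crossMap G u μ Y) = crossSaturation G u μ Y U := by
  refine (range_subset_iff.2 (crossMap_mem_crossSaturation hU hU1)).antisymm ?_
  rintro _ ⟨g, -, x, hx, rfl⟩
  rw [← image_crossMap_prod_univ hU] at hx
  obtain ⟨⟨h, p⟩, -, rfl⟩ := hx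
  exact ⟨(g * h, p), crossMap_mul g h p⟩

variable [LocallyCompactSpace G] [SecondCountableTopology G] [T2Space G]
  [MeasurableSpace G] [BorelSpace G] {lam : Measure G} [lam.IsHaarMeasure]
  [∀ n, StandardBorelSpace (X n)] [∀ n, MeasurableSMul₂ G (X n)]
  [∀ n, IsProbabilityMeasure (μ n)]
  {ν : ∀ n, Measure (Y n)} {c : ℕ → ℝ} {c₀ : ℝ}

/-- For `V` close to `1`, the set `V K A_n \ K A_n` is contained in `(V K \ K) A_n`, whose measure
is at most `λ(V K \ K) / c_n ≤ λ(V K \ K) / λ(U')`. -/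
theorem isRegularSeq_image_smul (hU' : IsOpen U') (hU'1 : (1 : G) ∈ U')
    (hY : ∀ n, IsCrossSection U' (μ n) (Y n))
    (hdata : ∀ n, IsCrossData lam U' (μ n) (Y n) (ν n) (c n)) {K : Set G} (hK : IsCompact K)
    (hKU : K ⊆ U') {A : ∀ n, Set (Y n)} (hA : ∀ n, MeasurableSet (A n)) :
    IsRegularSeq G u μ fun n => (fun p : G × Y n => p.1 • (p.2 : X n)) '' (K ×ˢ A n) := by
  have hmeas : ∀ {L : Set G}, MeasurableSet L → L ⊆ U' → ∀ n,
      MeasurableSet ((fun p : G × Y n => p.1 • (p.2 : X n)) '' (L ×ˢ A n)) := fun hL hLU n =>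
    (hY n).measurableSet_image (hL.prod (hA n)) (prod_mono hLU (subset_univ _))
  refine ⟨.of_forall fun n => (hmeas hK.measurableSet hKU n).nullMeasurableSet, fun ε hε => ?_⟩
  have hlam : lam U' ≠ 0 := (hU'.measure_pos lam ⟨1, hU'1⟩).ne'
  obtain ⟨O, hKO, hO, hOε⟩ := hK.exists_isOpen_lt_add (μ := lam) (ε := ε * lam U')
    (mul_ne_zero hε.ne' hlam)
  obtain ⟨V, hV, hVK⟩ := compact_open_separated_mul_left hK (hO.inter hU')
    (subset_inter hKO hKU)
  obtain ⟨V₁, hV₁, hV₁V, hV₁c⟩ := local_compact_nhds hV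
  have hV₁K : V₁ * K ⊆ O ∩ U' := (mul_subset_mul_right hV₁V).trans hVK
  have hcomp : IsCompact (V₁ * K) := hV₁c.mul hK
  have heq : ∀ n, V₁ • ((fun p : G × Y n => p.1 • (p.2 : X n)) '' (K ×ˢ A n)) =
      (fun p : G × Y n => p.1 • (p.2 : X n)) '' ((V₁ * K) ×ˢ A n) := by
    intro n
    ext x
    constructor
    · rintro ⟨v, hv, _, ⟨⟨k, y⟩, ⟨hk, hy⟩, rfl⟩, rfl⟩
      exact ⟨(v * k, y), ⟨mul_mem_mul hv hk, hy⟩, mul_smul _ _ _⟩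
    · rintro ⟨⟨_, y⟩, ⟨⟨v, hv, k, hk, rfl⟩, hy⟩, rfl⟩
      exact ⟨v, hv, _, ⟨(k, y), ⟨hk, hy⟩, rfl⟩, (mul_smul _ _ _).symm⟩
  refine ⟨V₁, ⟨hV₁c.measurableSet, hV₁, V₁, hV₁c, subset_rfl⟩, ?_, ?_⟩
  · simp only [heq]
    exact .of_forall fun n => (hmeas hcomp.measurableSet
      (hV₁K.trans inter_subset_right) n).nullMeasurableSet
  · refine .of_forall fun n => ?_
    have := (hdata n).1
    have hsub : ((V₁ * K) \ K) ×ˢ A n ⊆ U' ×ˢ univ :=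
      prod_mono (sdiff_subset.trans (hV₁K.trans inter_subset_right)) (subset_univ _)
    have hcn : ENNReal.ofReal (c n) ≠ 0 := (ENNReal.ofReal_pos.2 (hdata n).2.1).ne'
    rw [heq]
    refine (measure_mono (t := (fun p : G × Y n => p.1 • (p.2 : X n)) ''
      (((V₁ * K) \ K) ×ˢ A n)) ?_).trans ?_
    · rintro _ ⟨⟨⟨k, y⟩, ⟨hk, hy⟩, rfl⟩, hx⟩
      exact ⟨(k, y), ⟨⟨hk, fun hkK => hx ⟨(k, y), ⟨hkK, hy⟩, rfl⟩⟩, hy⟩, rfl⟩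
    · rw [← ENNReal.mul_le_mul_iff_right hcn ENNReal.ofReal_ne_top,
        (hdata n).ofReal_mul_measure_image (hY n)
          ((hcomp.measurableSet.diff hK.measurableSet).prod (hA n)) hsub, Measure.prod_prod]
      calc lam ((V₁ * K) \ K) * ν n (A n) ≤ lam (O \ K) * 1 :=
            mul_le_mul' (measure_mono (sdiff_subset_sdiff_left (hV₁K.trans inter_subset_left)))
              prob_le_one
        _ ≤ ε * lam U' := by
            rw [mul_one, measure_sdiff hKO hK.measurableSet.nullMeasurableSet
              hK.measure_lt_top.ne]
            exact tsub_le_iff_left.2 hOε.le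
        _ ≤ ε * (ENNReal.ofReal (c n) * 1) := by
            rw [(hY n).lam_eq hU' (hdata n)]
            exact mul_le_mul_right (mul_le_mul_right prob_le_one _) _
        _ = ENNReal.ofReal (c n) * ε := by rw [mul_one, mul_comm]

theorem nullMeasurableSet_of_measure_add_measure_compl_le {α : Type*} [MeasurableSpace α]
    {m : Measure α} [IsFiniteMeasure m] {s : Set α} (h : m s + m sᶜ ≤ m univ) :
    NullMeasurableSet s m := by
  set T := toMeasurable m s with hT
  set T' := toMeasurable m sᶜ with hT'
  have hTm : MeasurableSet T := measurableSet_toMeasurable _ _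
  have hsT : s ⊆ T := subset_toMeasurable _ _
  have hsT' : sᶜ ⊆ T' := subset_toMeasurable _ _
  have hun : T ∪ T' = univ := eq_univ_of_forall fun x =>
    (em (x ∈ s)).imp (fun h => hsT h) (fun h => hsT' h)
  have hadd := measure_union_add_inter' hTm T' (μ := m)
  rw [hun, hT, hT', measure_toMeasurable, measure_toMeasurable, ← hT, ← hT'] at hadd
  have hnull : m (T ∩ T') = 0 := by
    have : m univ + m (T ∩ T') ≤ m univ + 0 := by rw [hadd, add_zero]; exact h
    exact nonpos_iff_eq_zero.1 ((ENNReal.add_le_add_iff_left (measure_ne_top _ _)).1 this)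
  have heq : s = T \ (T \ s) := by rw [sdiff_sdiff_right_self]; exact (inter_eq_right.2 hsT).symm
  rw [heq]
  exact hTm.nullMeasurableSet.diff (NullMeasurableSet.of_null
    (measure_mono_null (show T \ s ⊆ T ∩ T' from fun x hx => ⟨hx.1, hsT' hx.2⟩) hnull))

/-- The measures of a set and of its image under `Ψ` satisfy one inequality by the central
estimate. Applying it to the complement as well forces equality, and measurability. -/
theorem nullMeasurableSet_and_measure_eq_of_image (hu : (u : Filter ℕ) ≤ cofinite)
    (hU' : IsOpen U') (hU'1 : (1 : G) ∈ U') (hY : ∀ n, IsCrossSection U' (μ n) (Y n))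
    (hdata : ∀ n, IsCrossData lam U' (μ n) (Y n) (ν n) (c n))
    (hc : Tendsto c u (𝓝 c₀)) (hc₀ : 0 < c₀) (hU : IsCompact U) (hUU' : U ⊆ U')
    {A : Set (G × Ultraproduct u fun n => Y n)} (hAU : A ⊆ U ×ˢ univ)
    (hA : NullMeasurableSet (crossMap G u μ Y '' A) (regMeasure G u μ)) :
    NullMeasurableSet A (lam.prod (loebMeasure u ν)) ∧
      lam.prod (loebMeasure u ν) A =
        ENNReal.ofReal c₀ * regMeasure G u μ (crossMap G u μ Y '' A) := by
  have hν : ∀ n, IsProbabilityMeasure (ν n) := fun n => (hdata n).1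
  have : ∀ n, Nonempty (Y n) := fun n => nonempty_of_isProbabilityMeasure (ν n)
  have := isProbabilityMeasure_loebMeasure (μ := ν) hu
  have := isProbabilityMeasure_regMeasure (G := G) (μ := μ) hu
  set ρ := lam.prod (loebMeasure u ν)
  set m := regMeasure G u μ
  set Ψ := crossMap G u μ Y
  set T : Set (G × Ultraproduct u fun n => Y n) := U ×ˢ univ
  have hTm : MeasurableSet T := hU.measurableSet.prod .univ
  have hle : ∀ E ⊆ T, ρ E ≤ ENNReal.ofReal c₀ * m (Ψ '' E) := by
    intro E hE
    refine le_trans ?_ (measure_preimage_crossMap_le hu hU' hY hdata hc hc₀ (Ψ '' E))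
    conv_rhs => rw [← Measure.restrict_univ (μ := loebMeasure u ν)]
    rw [Measure.prod_restrict, Measure.restrict_apply' (hU'.measurableSet.prod .univ)]
    exact measure_mono fun p hp => ⟨mem_image_of_mem _ hp, hUU' (hE hp).1, mem_univ _⟩
  have hreg : IsRegularSeq G u μ
      fun n => (fun p : G × Y n => p.1 • (p.2 : X n)) '' (U ×ˢ univ) :=
    isRegularSeq_image_smul hU' hU'1 hY hdata hU hUU' fun n => .univ
  have hΨT : Ψ '' T = regSet G u μ
      fun n => (fun p : G × Y n => p.1 • (p.2 : X n)) '' (U ×ˢ univ) := by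
    rw [← image_crossMap_prod_internalSet hU, internalSet_univ]
  have htot : ρ T = ENNReal.ofReal c₀ * m (Ψ '' T) := by
    have hlim := (ENNReal.Tendsto.mul (ENNReal.tendsto_ofReal hc)
      (.inl (ENNReal.ofReal_pos.2 hc₀).ne')
      (tendsto_regMeasure_regSet hu hreg fun n => (hY n).measurableSet_image
        (hU.measurableSet.prod .univ) (prod_mono hUU' subset_rfl)) (.inr ENNReal.ofReal_ne_top))
    rw [hΨT]
    refine tendsto_nhds_unique (tendsto_const_nhds.congr fun n => ?_) hlim
    rw [(hdata n).ofReal_mul_measure_image (hY n) (hU.measurableSet.prod .univ)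
      (prod_mono hUU' subset_rfl), Measure.prod_prod, measure_univ, Measure.prod_prod,
      measure_univ]
  have hTfin : ρ T ≠ ∞ := by
    rw [htot]
    exact ENNReal.mul_ne_top ENNReal.ofReal_ne_top (measure_ne_top _ _)
  have hinj : InjOn Ψ T := (injOn_crossMap hU' hY).mono (prod_mono hUU' subset_rfl)
  have hsum : m (Ψ '' A) + m (Ψ '' (T \ A)) = m (Ψ '' T) := by
    rw [hinj.image_sdiff_subset hAU]
    have := measure_inter_add_sdiff₀ (Ψ '' T) hA
    rwa [inter_eq_right.2 (image_mono hAU)] at this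
  have hAfin : ρ (T \ A) ≠ ∞ := measure_ne_top_of_subset sdiff_subset hTfin
  have hsumle : ρ A + ρ (T \ A) ≤ ρ T := by
    rw [htot, ← hsum, mul_add]
    exact add_le_add (hle A hAU) (hle _ sdiff_subset)
  refine ⟨?_, le_antisymm (hle A hAU) ?_⟩
  · have : IsFiniteMeasure (ρ.restrict T) := ⟨by simpa using hTfin.lt_top⟩
    have hnull : NullMeasurableSet A (ρ.restrict T) := by
      refine nullMeasurableSet_of_measure_add_measure_compl_le ?_
      rw [Measure.restrict_apply' hTm, Measure.restrict_apply' hTm, Measure.restrict_apply_univ,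
        inter_eq_left.2 hAU, inter_comm, ← sdiff_eq]
      exact hsumle
    have := (nullMeasurableSet_restrict hTm.nullMeasurableSet).1 hnull
    rwa [inter_eq_left.2 hAU] at this
  · have h1 : ENNReal.ofReal c₀ * m (Ψ '' A) + ρ (T \ A) ≤ ρ A + ρ (T \ A) := by
      calc _ ≤ ENNReal.ofReal c₀ * m (Ψ '' A) + ENNReal.ofReal c₀ * m (Ψ '' (T \ A)) :=
            add_le_add_right (hle _ sdiff_subset) _
        _ = ρ T := by rw [← mul_add, hsum, htot]
        _ ≤ ρ A + ρ (T \ A) := by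
            refine (measure_mono ?_).trans (measure_union_le _ _)
            rw [union_sdiff_self]
            exact subset_union_right
    exact (ENNReal.add_le_add_iff_right hAfin).1 h1

/-- The images under `Ψ` of the rectangles `F × [B_n]`, with `F` closed, are regular sets, and `Ψ`
is injective on `U × Y_u`, so that taking images commutes with complements. -/
theorem nullMeasurableSet_image_crossMap (hu : (u : Filter ℕ) ≤ cofinite)
    (hU' : IsOpen U') (hU'1 : (1 : G) ∈ U') (hY : ∀ n, IsCrossSection U' (μ n) (Y n))
    (hdata : ∀ n, IsCrossData lam U' (μ n) (Y n) (ν n) (c n))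
    (hc : Tendsto c u (𝓝 c₀)) (hc₀ : 0 < c₀) (hU : IsCompact U) (hUU' : U ⊆ U')
    {A : Set (G × Ultraproduct u fun n => Y n)} (hAU : A ⊆ U ×ˢ univ)
    (hA : NullMeasurableSet A (lam.prod (loebMeasure u ν))) :
    NullMeasurableSet (crossMap G u μ Y '' A) (regMeasure G u μ) := by
  have hν : ∀ n, IsProbabilityMeasure (ν n) := fun n => (hdata n).1
  have : ∀ n, Nonempty (Y n) := fun n => nonempty_of_isProbabilityMeasure (ν n)
  set Ψ := crossMap G u μ Y
  set T : Set (G × Ultraproduct u fun n => Y n) := U ×ˢ univ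
  have hTm : MeasurableSet T := hU.measurableSet.prod .univ
  have hinj : InjOn Ψ T := (injOn_crossMap hU' hY).mono (prod_mono hUU' subset_rfl)
  have hrect : ∀ F : Set G, IsClosed F → ∀ B : ∀ n, Set (Y n), (∀ n, MeasurableSet (B n)) →
      MeasurableSet (Ψ '' ((F ×ˢ internalSet u B) ∩ T)) := by
    intro F hF B hB
    rw [prod_inter_prod, inter_univ, image_crossMap_prod_internalSet (hU.inter_left hF)]
    exact measurableSet_regSet (isRegularSeq_image_smul hU' hU'1 hY hdata (hU.inter_left hF)
      (inter_subset_right.trans hUU') hB)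
  have hΨT : MeasurableSet (Ψ '' T) := by
    have := hrect univ isClosed_univ (fun n => univ) fun n => .univ
    rwa [internalSet_univ, univ_prod_univ, univ_inter] at this
  have hmeas : ∀ E, MeasurableSet E → MeasurableSet (Ψ '' (E ∩ T)) := by
    intro E hE
    have hgen : MeasurableSpace.generateFrom (image2 (· ×ˢ ·) {F : Set G | IsClosed F}
        {S | ∃ B : ∀ n, Set (Y n), (∀ n, MeasurableSet (B n)) ∧ S = internalSet u B}) =
        Prod.instMeasurableSpace := by
      refine generateFrom_eq_prod ?_ rfl ⟨fun _ => univ, fun _ => isClosed_univ, iUnion_const _⟩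
        ⟨fun _ => univ, fun _ => ⟨fun _ => univ, fun _ => .univ, internalSet_univ.symm⟩,
          iUnion_const _⟩
      rw [BorelSpace.measurable_eq (α := G), borel_eq_generateFrom_isClosed]
    rw [← hgen] at hE
    induction E, hE using MeasurableSpace.generateFrom_induction with
    | hC E hE _ =>
      obtain ⟨F, hF, _, ⟨B, hB, rfl⟩, rfl⟩ := hE
      exact hrect F hF B hB
    | empty => simp
    | compl E _ ih =>
      rw [show Eᶜ ∩ T = T \ (E ∩ T) by ext; simp; tauto, hinj.image_sdiff_subset inter_subset_right]
      exact hΨT.diff ih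
    | iUnion f _ ih =>
      rw [iUnion_inter, image_iUnion]
      exact .iUnion ih
  obtain ⟨E, hEA, hE, hEeq⟩ := hA.exists_measurable_subset_ae_eq
  have hnull : lam.prod (loebMeasure u ν) (A \ E) = 0 := ae_le_set.1 hEeq.symm.le
  -- a null set is contained in a measurable null set, whose image is measurable
  have hN : regMeasure G u μ (Ψ '' (A \ E)) = 0 := by
    set N := toMeasurable (lam.prod (loebMeasure u ν)) (A \ E)
    have hNm := hmeas N (measurableSet_toMeasurable _ _)
    have heq := (nullMeasurableSet_and_measure_eq_of_image hu hU' hU'1 hY hdata hc hc₀ hU hUU'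
      (inter_subset_right (s := N)) hNm.nullMeasurableSet).2
    have h0 : lam.prod (loebMeasure u ν) (N ∩ T) = 0 :=
      measure_mono_null inter_subset_left ((measure_toMeasurable _).trans hnull)
    rw [h0] at heq
    have := (mul_eq_zero.1 heq.symm).resolve_left (ENNReal.ofReal_pos.2 hc₀).ne'
    exact measure_mono_null (image_mono (subset_inter (subset_toMeasurable _ _)
      (sdiff_subset.trans hAU))) this
  have hEm := hmeas E hE
  rw [inter_eq_left.2 (hEA.trans hAU)] at hEm
  rw [← union_sdiff_cancel hEA, image_union]
  exact hEm.nullMeasurableSet.union (NullMeasurableSet.of_null hN)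

variable [∀ n, SMulInvariantMeasure G (X n) (μ n)]

/-- The saturation is a countable union of translates of one regular set. -/
theorem measurableSet_crossSaturation
    (hU' : IsOpen U') (hU'1 : (1 : G) ∈ U') (hY : ∀ n, IsCrossSection U' (μ n) (Y n))
    (hdata : ∀ n, IsCrossData lam U' (μ n) (Y n) (ν n) (c n)) (hU : IsCompact U)
    (hU1 : U ∈ 𝓝 (1 : G)) (hUU' : U ⊆ U') :
    MeasurableSet (crossSaturation G u μ Y U : Set (RegUltraproduct G u μ)) := by
  have hν : ∀ n, IsProbabilityMeasure (ν n) := fun n => (hdata n).1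
  have : ∀ n, Nonempty (Y n) := fun n => nonempty_of_isProbabilityMeasure (ν n)
  have hreg := isRegularSeq_image_smul (u := u) hU' hU'1 hY hdata hU hUU' fun n => .univ
  simp only [image_smul_coe_prod_univ] at hreg
  obtain ⟨d, hd⟩ := exists_seq_iUnion_smul_eq_univ hU1
  have heq : (crossSaturation G u μ Y U : Set (RegUltraproduct G u μ)) =
      ⋃ i, d i • regSet G u μ fun n => U • Y n := by
    refine Subset.antisymm ?_ (iUnion_subset fun i => ?_)
    · rw [← range_crossMap hU (mem_of_mem_nhds hU1)]
      rintro _ ⟨⟨g, p⟩, rfl⟩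
      obtain ⟨i, h, hh, hg⟩ := mem_iUnion.1 (hd.ge (mem_univ g))
      refine mem_iUnion.2 ⟨i, crossMap G u μ Y (h, p), ?_, ?_⟩
      · rw [← image_crossMap_prod_univ hU]
        exact mem_image_of_mem _ ⟨hh, mem_univ _⟩
      · exact (crossMap_mul (d i) h p).symm.trans (by rw [← hg]; rfl)
    · rintro _ ⟨x, hx, rfl⟩
      exact ⟨d i, mem_univ _, x, hx, rfl⟩
  rw [heq]
  refine .iUnion fun i => ?_
  rw [smul_regSet]
  exact measurableSet_regSet (hreg.smul _)

/-- On `U × Y_u` the preimage of `D` has the null-measurable image `D ∩ Ψ(U × Y_u)`; countably many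
translates of `U` cover `G`. -/
theorem nullMeasurableSet_preimage_crossMap (hu : (u : Filter ℕ) ≤ cofinite)
    (hU' : IsOpen U') (hU'1 : (1 : G) ∈ U') (hY : ∀ n, IsCrossSection U' (μ n) (Y n))
    (hdata : ∀ n, IsCrossData lam U' (μ n) (Y n) (ν n) (c n))
    (hc : Tendsto c u (𝓝 c₀)) (hc₀ : 0 < c₀) (hU : IsCompact U) (hU1 : U ∈ 𝓝 (1 : G))
    (hUU' : U ⊆ U') {D : Set (RegUltraproduct G u μ)}
    (hD : NullMeasurableSet D (regMeasure G u μ)) :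
    NullMeasurableSet (crossMap G u μ Y ⁻¹' D) (lam.prod (loebMeasure u ν)) := by
  have hν : ∀ n, IsProbabilityMeasure (ν n) := fun n => (hdata n).1
  have := isProbabilityMeasure_loebMeasure (μ := ν) hu
  have hloc : ∀ D, NullMeasurableSet D (regMeasure G u μ) →
      NullMeasurableSet (crossMap G u μ Y ⁻¹' D ∩ U ×ˢ univ) (lam.prod (loebMeasure u ν)) := by
    intro D hD
    refine (nullMeasurableSet_and_measure_eq_of_image hu hU' hU'1 hY hdata hc hc₀ hU hUU'
      inter_subset_right ?_).1
    rw [image_preimage_inter]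
    refine hD.inter (nullMeasurableSet_image_crossMap hu hU' hU'1 hY hdata hc hc₀ hU hUU'
      subset_rfl (hU.measurableSet.prod .univ).nullMeasurableSet)
  obtain ⟨d, hd⟩ := exists_seq_iUnion_smul_eq_univ hU1
  have heq : crossMap G u μ Y ⁻¹' D = ⋃ i, (Prod.map (fun h => (d i)⁻¹ * h) id) ⁻¹'
      (crossMap G u μ Y ⁻¹' ((fun x => d i • x) ⁻¹' D) ∩ U ×ˢ univ) := by
    ext ⟨g, p⟩
    simp only [mem_iUnion, mem_preimage, Prod.map_apply, id, mem_inter_iff, mem_prod, mem_univ,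
      and_true, ← crossMap_mul, mul_inv_cancel_left, exists_and_left, iff_self_and]
    intro _
    obtain ⟨i, hi⟩ := mem_iUnion.1 (hd.ge (mem_univ g))
    exact ⟨i, mem_smul_set_iff_inv_smul_mem.1 hi⟩
  rw [heq]
  refine .iUnion fun i => (hloc _ ?_).preimage
    ((measurePreserving_mul_left lam (d i)⁻¹).prod
      (MeasurePreserving.id _)).quasiMeasurePreserving
  exact (isContinuousAction_regMeasure hu).measurable (d i) D hD

end External

/-! ### The normalized measure on the saturation -/

section Saturation

variable {G : Type*} [Group G] [TopologicalSpace G] [IsTopologicalGroup G]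
  {u : Ultrafilter ℕ} {X : ℕ → Type*} [∀ n, MeasurableSpace (X n)]
  [∀ n, MulAction G (X n)] {μ : ∀ n, Measure (X n)} {Y : ∀ n, Set (X n)} {U : Set G}

theorem val_image_smul (g : G) (A : Set (crossSaturation G u μ Y U)) :
    Subtype.val '' (g • A) = g • (Subtype.val '' A) := by
  simp only [← image_smul, image_image]
  rfl

variable [MeasurableSpace G]

theorem saturationMeasure_apply
    (hZ : MeasurableSet (crossSaturation G u μ Y U : Set (RegUltraproduct G u μ)))
    (A : Set (crossSaturation G u μ Y U)) :
    saturationMeasure G u μ Y U A =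
      (regMeasure G u μ (crossSaturation G u μ Y U : Set (RegUltraproduct G u μ)))⁻¹ *
        regMeasure G u μ (Subtype.val '' A) := by
  have he : MeasurableEmbedding
      (Subtype.val : crossSaturation G u μ Y U → RegUltraproduct G u μ) :=
    MeasurableEmbedding.subtype_coe hZ
  rw [saturationMeasure, Measure.smul_apply, smul_eq_mul, he.comap_apply]

theorem nullMeasurableSet_saturationMeasure_iff
    (hZ : MeasurableSet (crossSaturation G u μ Y U : Set (RegUltraproduct G u μ)))
    (htop : regMeasure G u μ (crossSaturation G u μ Y U : Set (RegUltraproduct G u μ)) ≠ ∞)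
    {A : Set (crossSaturation G u μ Y U)} :
    NullMeasurableSet A (saturationMeasure G u μ Y U) ↔
      NullMeasurableSet (Subtype.val '' A) (regMeasure G u μ) := by
  constructor
  · rintro ⟨B, hB, hAB⟩
    refine ⟨Subtype.val '' B, hZ.subtype_image hB, ?_⟩
    rw [← measure_symmDiff_eq_zero_iff, saturationMeasure_apply hZ] at hAB
    rw [← measure_symmDiff_eq_zero_iff, ← image_symmDiff Subtype.val_injective]
    exact (mul_eq_zero.1 hAB).resolve_left (ENNReal.inv_ne_zero.2 htop)
  · intro hA
    have hq : Measure.QuasiMeasurePreserving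
        (Subtype.val : crossSaturation G u μ Y U → RegUltraproduct G u μ)
        (saturationMeasure G u μ Y U) (regMeasure G u μ) := by
      refine ⟨measurable_subtype_coe, Measure.AbsolutelyContinuous.mk fun s hs h0 => ?_⟩
      rw [Measure.map_apply measurable_subtype_coe hs, saturationMeasure_apply hZ,
        measure_mono_null (image_preimage_subset _ _) h0, mul_zero]
    rw [← preimage_image_eq A Subtype.val_injective]
    exact hA.preimage hq

theorem isContinuousAction_saturationMeasure
    (hZ : MeasurableSet (crossSaturation G u μ Y U : Set (RegUltraproduct G u μ)))
    (h0 : regMeasure G u μ (crossSaturation G u μ Y U : Set (RegUltraproduct G u μ)) ≠ 0)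
    (htop : regMeasure G u μ (crossSaturation G u μ Y U : Set (RegUltraproduct G u μ)) ≠ ∞)
    (h : IsContinuousAction G (regMeasure G u μ)) :
    IsContinuousAction G (saturationMeasure G u μ Y U) := by
  refine ⟨fun g A hA => ?_, fun g A hA => ?_, fun A hA ε hε => ?_⟩
  · rw [nullMeasurableSet_saturationMeasure_iff hZ htop] at hA ⊢
    rw [preimage_smul, val_image_smul, ← preimage_smul]
    exact h.measurable g _ hA
  · rw [nullMeasurableSet_saturationMeasure_iff hZ htop] at hA
    rw [saturationMeasure_apply hZ, saturationMeasure_apply hZ, preimage_smul, val_image_smul,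
      ← preimage_smul, h.measure_preimage g _ hA]
  · rw [nullMeasurableSet_saturationMeasure_iff hZ htop] at hA
    obtain ⟨V, hV, hle⟩ := h.continuous _ hA _ (ENNReal.mul_pos h0 hε.ne')
    refine ⟨V, hV, fun g hg => ?_⟩
    rw [saturationMeasure_apply hZ, image_symmDiff Subtype.val_injective, val_image_smul]
    calc _ ≤ _ := mul_le_mul_right (hle g hg) _
      _ = ε := by rw [← mul_assoc, ENNReal.inv_mul_cancel h0 htop, one_mul]

end Saturation

end CrossUltra

theorem mainTheorem8 {G : Type*} [Group G] [TopologicalSpace G] [IsTopologicalGroup G]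
    [LocallyCompactSpace G] [SecondCountableTopology G] [T2Space G]
    [MeasurableSpace G] [BorelSpace G]
    (lam : Measure G) [lam.IsHaarMeasure] [lam.IsMulRightInvariant]
    (u : Ultrafilter ℕ) (hu : (u : Filter ℕ) ≤ Filter.cofinite)
    {X : ℕ → Type*} [∀ n, MeasurableSpace (X n)] [∀ n, StandardBorelSpace (X n)]
    [∀ n, MulAction G (X n)] [∀ n, MeasurableSMul₂ G (X n)]
    (μ : ∀ n, Measure (X n)) [∀ n, IsProbabilityMeasure (μ n)]
    [∀ n, SMulInvariantMeasure G (X n) (μ n)]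
    (U' : Set G) (hU'_open : IsOpen U') (hU'_one : (1 : G) ∈ U')
    (Y : ∀ n, Set (X n)) (hY : ∀ n, CrossUltra.IsCrossSection U' (μ n) (Y n))
    (hcovol : ∃ C : ℝ, ∀ n, CrossUltra.covol lam U' (μ n) (Y n) ≤ C)
    (U : Set G) (hU_compact : IsCompact U) (hU_nhds : U ∈ 𝓝 (1 : G)) (hUU' : U ⊆ U') :
    NullMeasurableSet
      (CrossUltra.crossSaturation G u μ Y U : Set (CrossUltra.RegUltraproduct G u μ))
      (CrossUltra.regMeasure G u μ) ∧
    ∃ c : ℝ, Tendsto (fun n => CrossUltra.covol lam U' (μ n) (Y n)) u (𝓝 c) ∧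
    ∃ hΨ : ∀ p, CrossUltra.crossMap G u μ Y p ∈ CrossUltra.crossSaturation G u μ Y U,
      CrossUltra.IsExternalCrossSection lam U
        (CrossUltra.saturationMeasure G u μ Y U)
        (CrossUltra.loebMeasure u
          (fun n => CrossUltra.crossMeasure lam U' (μ n) (Y n)))
        (fun p => (⟨CrossUltra.crossMap G u μ Y p, hΨ p⟩ : CrossUltra.crossSaturation G u μ Y U))
        (c * (CrossUltra.regMeasure G u μ).real
          (CrossUltra.crossSaturation G u μ Y U : Set (CrossUltra.RegUltraproduct G u μ))) := by
  open CrossUltra in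
  have hdata := fun n => isCrossData_crossMeasure lam hU'_open hU'_one (hY n)
  have hν : ∀ n, IsProbabilityMeasure (crossMeasure lam U' (μ n) (Y n)) := fun n => (hdata n).1
  have hne : ∀ n, Nonempty (Y n) := fun n =>
    nonempty_of_isProbabilityMeasure (crossMeasure lam U' (μ n) (Y n))
  have hprob := isProbabilityMeasure_regMeasure (G := G) (μ := μ) hu
  have hU1 : (1 : G) ∈ U := mem_of_mem_nhds hU_nhds
  have hΨ := crossMap_mem_crossSaturation (u := u) (μ := μ) (Y := Y) hU_compact hU1
  have hZ : MeasurableSet (crossSaturation G u μ Y U : Set (RegUltraproduct G u μ)) :=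
    measurableSet_crossSaturation hU'_open hU'_one hY hdata hU_compact hU_nhds hUU'
  -- the covolumes lie in a compact interval, and `λ(U') ≤ covol (Y n)` bounds them below
  obtain ⟨c, hc⟩ : ∃ c, Tendsto (fun n => covol lam U' (μ n) (Y n)) u (𝓝 c) := by
    obtain ⟨C, hC⟩ := hcovol
    obtain ⟨c, -, hc⟩ := isCompact_Icc.ultrafilter_le_nhds
      (u.map fun n => covol lam U' (μ n) (Y n))
      (le_principal_iff.2 (Ultrafilter.mem_map.2 (univ_mem' fun n => ⟨(hdata n).2.1.le, hC n⟩)))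
    exact ⟨c, hc⟩
  have hc₀ : 0 < c := by
    have hle : lam U' ≤ ENNReal.ofReal c := by
      refine ge_of_tendsto (ENNReal.tendsto_ofReal hc) (.of_forall fun n => ?_)
      rw [(hY n).lam_eq hU'_open (hdata n)]
      exact mul_le_of_le_one_right' prob_le_one
    exact ENNReal.ofReal_pos.1 ((hU'_open.measure_pos lam ⟨1, hU'_one⟩).trans_le hle)
  have himage := fun A (hAU : A ⊆ U ×ˢ univ) hA =>
    nullMeasurableSet_image_crossMap hu hU'_open hU'_one hY hdata hc hc₀ hU_compact hUU'
      (A := A) hAU hA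
  have hmeasure := fun A (hAU : A ⊆ U ×ˢ univ) hA =>
    (nullMeasurableSet_and_measure_eq_of_image hu hU'_open hU'_one hY hdata hc hc₀ hU_compact
      hUU' hAU (himage A hAU hA)).2
  have hUnull : NullMeasurableSet (U ×ˢ (univ : Set (Ultraproduct u fun n => Y n)))
      (lam.prod (loebMeasure u fun n => crossMeasure lam U' (μ n) (Y n))) :=
    (hU_compact.measurableSet.prod .univ).nullMeasurableSet
  have hν_loeb : IsProbabilityMeasure
      (loebMeasure u fun n => crossMeasure lam U' (μ n) (Y n)) :=
    isProbabilityMeasure_loebMeasure hu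
  have h0 : regMeasure G u μ (crossSaturation G u μ Y U : Set (RegUltraproduct G u μ)) ≠ 0 := by
    intro h0
    have h := hmeasure _ subset_rfl hUnull
    rw [measure_mono_null (image_subset_iff.2 fun p _ => hΨ p) h0, mul_zero, Measure.prod_prod,
      measure_univ, mul_one] at h
    exact (Measure.measure_pos_of_mem_nhds lam hU_nhds).ne' h
  have htop := measure_ne_top (regMeasure G u μ)
    (crossSaturation G u μ Y U : Set (RegUltraproduct G u μ))
  have hval : ∀ A, Subtype.val '' ((fun p => (⟨crossMap G u μ Y p, hΨ p⟩ :
      crossSaturation G u μ Y U)) '' A) = crossMap G u μ Y '' A := fun A => image_image _ _ _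
  have hrange : range (fun p => (⟨crossMap G u μ Y p, hΨ p⟩ : crossSaturation G u μ Y U)) =
      univ := by
    refine eq_univ_of_forall fun ⟨x, hx⟩ => ?_
    obtain ⟨p, rfl⟩ := (range_crossMap hU_compact hU1).ge hx
    exact ⟨p, rfl⟩
  refine ⟨hZ.nullMeasurableSet, c, hc, hΨ, ?_⟩
  exact
    { isProbabilityMeasure := ⟨by
        rw [saturationMeasure_apply hZ, image_univ, Subtype.range_val]
        exact ENNReal.inv_mul_cancel h0 htop⟩
      action := isContinuousAction_saturationMeasure hZ h0 htop
        (isContinuousAction_regMeasure hu)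
      isProbabilityMeasure_section := hν_loeb
      covol_pos := mul_pos hc₀ (ENNReal.toReal_pos h0 htop)
      equivariant := fun g h y => Subtype.ext (crossMap_mul g h y)
      measurable := fun D hD => by
        have := nullMeasurableSet_preimage_crossMap hu hU'_open hU'_one hY hdata hc hc₀
          hU_compact hU_nhds hUU' ((nullMeasurableSet_saturationMeasure_iff hZ htop).1 hD)
        convert this using 1
        ext p
        simp [hΨ p]
      measurable_image_univ := by
        rw [nullMeasurableSet_saturationMeasure_iff hZ htop, hval]
        exact himage _ subset_rfl hUnull
      injOn := fun p hp q hq hpq => injOn_crossMap hU'_open hY ⟨hUU' hp.1, hp.2⟩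
        ⟨hUU' hq.1, hq.2⟩ (congrArg Subtype.val hpq)
      measurable_image := fun A hAU hA => by
        rw [nullMeasurableSet_saturationMeasure_iff hZ htop, hval]
        exact himage A hAU hA
      measure_image := fun A hAU hA => by
        rw [saturationMeasure_apply hZ, hval, hmeasure A hAU hA, ENNReal.ofReal_mul hc₀.le,
          ofReal_measureReal, mul_assoc, ← mul_assoc (regMeasure G u μ _),
          ENNReal.mul_inv_cancel h0 htop, one_mul]
      measurable_range := by
        rw [hrange]
        exact .univ
      conull := by
        rw [hrange, compl_univ, measure_empty] }
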